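/- **Setting.** Let $I,J\ge 1$ be integers and let $\Omega$ be a finite or countable set of states with probabilities $(\pi_\omega)_{\omega\in\Omega}$. For each $\omega$ let $\mathcal X_\omega\subset\mathbb R^I$ be closed and bounded (not necessarily convex), let $\mathcal C\supseteq\bigcup_\omega\mathcal X_\omega$ be closed and bounded, put $\overline{\mathcal X}=\{\sum_\omega\pi_\omega x^\omega: x^\omega\in\mathrm{conv}\,\mathcal X_\omega\}$, and let $\mathcal Y\supseteq\overline{\mathcal X}$ be closed, bounded and convex. Let the real functions $f,g_1,\dots,g_J$ be convex on $\mathcal Y$ and Lipschitz on $\mathcal Y\cup\mathrm{conv}(\bigcup_\omega\mathcal X_\omega)$ with constants $M_f>0$ and $M_{gj}>0$. Assume that some $\hat x$ in the interior of $\overline{\mathcal X}$ has $g_j(\hat x)<0$ for all $j$. All norms are Euclidean. Let $f^{(\mathrm{opt})}$ be the infimum of $\limsup_{T\to\infty} f(\bar x(T))$, where $\bar x(T)=\frac1T\sum_{t=0}^{T-1}\mathbb E[x(t)]$, over all random decision processes with $x(t)\in\mathcal X_{\omega(t)}$, the states $\omega(t)$ being i.i.d. with law $\pi$, that satisfy $\limsup_{T\to\infty}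 g_j(\bar x(T))\le 0$ for all $j$. Let $$C=\sup_{x\in\mathcal C,\,y\in\mathcal Y}\tfrac12\big(\|g(y)\|^2+\|x-y\|^2\big).$$ For $\lambda=(w,z)\in\mathbb R_+^J\times\mathbb R^I$ define the dual function $$d(\lambda)=\inf\Big\{\sum_\omega\pi_\omega\big[f(y)+w^\top g(y)+z^\top(x^\omega-y)\big]:\ y\in\mathcal Y,\ x^\omega\in\mathrm{conv}\,\mathcal X_\omega\ (\omega\in\Omega)\Big\}.$$ Assume that $d$ has a unique maximizer $\lambda^*$ over $\mathbb R_+^J\times\mathbb R^I$ and that $L_P>0$ satisfies $d(\lambda^*)\ge d(\lambda)+L_P\|\lambda-\lambda^*\|$ for all $\lambda\in\mathbb R_+^J\times\mathbb R^I$. **Algorithm.** Let $V>0$, and let $W(0)\in\mathbb R_+^J$, $Z(0)\in\mathbb R^I$ be constants. In slot $t=0,1,2,\dots$ observe $\omega(t)$, choose $x(t)\in\mathcal X_{\omega(t)}$ minimizing $Z(t)^\top x$ over $\mathcal X_{\omega(t)}$, choose $y(t)\in\mathcal Y$ minimizing $Vf(y)+W(t)^\top g(y)-Z(t)^\top y$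 over $\mathcal Y$, and set $W_j(t+1)=\max(W_j(t)+g_j(y(t)),0)$ and $Z(t+1)=Z(t)+x(t)-y(t)$. Here $(\mathcal F_t)$ is a filtration, $\omega(t)$ has law $\pi$ and is independent of $\mathcal F_t$, and $\omega(t),x(t),y(t)$ are $\mathcal F_{t+1}$-measurable (ties may be broken arbitrarily subject to this). Put $Q(t)=(W(t),Z(t))$ and $$B_P=\max\Big(\frac{L_P}{2},\frac{2C}{L_P}\Big),\quad r_P=\frac{3L_P}{12C+L_P\sqrt{2C}},\quad \rho_P=1-\frac{r_PL_P}{4},\quad D_P=\frac{e^{r_PB_P}\big(e^{r_P\sqrt{2C}}-\rho_P\big)}{1-\rho_P},$$ $$U_P=\frac{\log(D_P+e^{r_PB_P})}{r_P},\qquad U_P'=\frac{2(D_P+e^{r_PB_P})}{r_P^2},\qquad T_P=\inf\{t\ge 0:\|Q(t)-V\lambda^*\|<B_P\}.$$ **Starting time.** $T_P$ is a stopping time; let $\mathcal F_{T_P}$ be the $\sigma$-algebra of the history up to $T_P$. Let $t_0$ be an $\mathcal F_{T_P}$-measurable random time with values in $\{0,1,2,\dots\}$ and let $A\in\mathcal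 F_{T_P}$ be an event with $\mathbb P(A)>0$ such that $t_0\ge T_P$ almost surely on $A$. (Examples: $A$ is the whole space and $t_0$ is a constant with $t_0\ge T_P$ almost surely, or $t_0=T_P$; or $t_0$ is any constant with $\mathbb P(T_P\le t_0)>0$ and $A=\{T_P\le t_0\}$.) For a positive integer $T$ put $\bar x(t_0,T)=\frac1T\sum_{t=t_0}^{t_0+T-1}x(t)$. **Theorem.** For every such $V$, run of the algorithm, $t_0$, $A$ and $T$, the random variables below are integrable and $$\mathbb E\big[f(\bar x(t_0,T))\,\big|\,A\big]-f^{(\mathrm{opt})}\le\frac{2M_fU_P}{T}+\frac{U_P'+4VU_P\|\lambda^*\|}{2TV}+\frac CV,$$ $$\mathbb E\big[g_j(\bar x(t_0,T))\,\big|\,A\big]\le\frac{2U_P}{T}+\frac{2M_{gj}U_P}{T}\qquad(j=1,\dots,J).$$ Consequently the convergence time in the steady state is $O(1/\epsilon)$: there is a constant $\kappa>0$, depending only on the problem data (not on $\epsilon$, the run, the initial condition, $t_0$, $A$ or $T$), such that for every $\epsilon>0$, with $V=1/\epsilon$, and for every integer $T\ge 1/\epsilon$, both $\mathbb E[f(\bar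 x(t_0,T))\mid A]-f^{(\mathrm{opt})}$ and every $\mathbb E[g_j(\bar x(t_0,T))\mid A]$ are at most $\kappa\epsilon$. -/

import Mathlib

open MeasureTheory ProbabilityTheory Filter

universe u v

noncomputable section

namespace DriftPlusPenalty

/-- Real Euclidean space of dimension `n`. -/
abbrev Vec (n : ℕ) : Type := EuclideanSpace ℝ (Fin n)

/-- Concatenations `(w, z)` of `w ∈ ℝ^J` and `z ∈ ℝ^I`, with the Euclidean norm of `ℝ^(J+I)`. -/
abbrev Mult (J I : ℕ) : Type := WithLp 2 (Vec J × Vec I)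

/-- The concatenation `(w, z)`. -/
def concat {J I : ℕ} (w : Vec J) (z : Vec I) : Mult J I := WithLp.toLp 2 (w, z)

/-- Data of a time-average stochastic optimization problem with an extended set. -/
structure Problem (Ω : Type u) (I J : ℕ) where
  /-- the distribution of the random state -/
  prob : PMF Ω
  /-- the (possibly non-convex) decision sets -/
  X : Ω → Set (Vec I)
  /-- a closed and bounded set containing all decision sets -/
  bigSet : Set (Vec I)
  /-- the extended set, from which the auxiliary vector is chosen -/
  Y : Set (Vec I)
  /-- the objective function -/
  f : Vec I → ℝ
  /-- the constraint functions -/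
  g : Fin J → Vec I → ℝ

namespace Problem

variable {Ω : Type u} {I J : ℕ} (P : Problem Ω I J)

/-- The probability of the state `a`, as a real number. -/
def wt (a : Ω) : ℝ := (P.prob a).toReal

/-- The weighted Minkowski sum of the convex hulls of the decision sets. -/
def avgSet : Set (Vec I) :=
  {v | ∃ xs : Ω → Vec I, (∀ a, xs a ∈ convexHull ℝ (P.X a)) ∧ v = ∑' a, P.wt a • xs a}

/-- The basic assumptions, including the Slater condition. -/
structure Standing : Prop where
  X_closed : ∀ a, IsClosed (P.X a)
  X_bounded : ∀ a, Bornology.IsBounded (P.X a)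
  bigSet_closed : IsClosed P.bigSet
  bigSet_bounded : Bornology.IsBounded P.bigSet
  X_subset : ∀ a, P.X a ⊆ P.bigSet
  Y_closed : IsClosed P.Y
  Y_bounded : Bornology.IsBounded P.Y
  Y_convex : Convex ℝ P.Y
  avgSet_subset : P.avgSet ⊆ P.Y
  f_convex : ConvexOn ℝ P.Y P.f
  g_convex : ∀ j, ConvexOn ℝ P.Y (P.g j)
  slater : ∃ x ∈ interior P.avgSet, ∀ j, P.g j x < 0

/-- The points at which `f` and the `g j` are evaluated: the extended set, and the averages of
decision vectors. -/
def evalSet : Set (Vec I) := P.Y ∪ convexHull ℝ (⋃ a, P.X a)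

/-- `Mf` and `Mg j` are Lipschitz constants of `f` and `g j`. -/
structure LipschitzConstants (Mf : ℝ) (Mg : Fin J → ℝ) : Prop where
  Mf_pos : 0 < Mf
  Mg_pos : ∀ j, 0 < Mg j
  f_lip : ∀ x ∈ P.evalSet, ∀ y ∈ P.evalSet, |P.f x - P.f y| ≤ Mf * ‖x - y‖
  g_lip : ∀ j, ∀ x ∈ P.evalSet, ∀ y ∈ P.evalSet, |P.g j x - P.g j y| ≤ Mg j * ‖x - y‖

/-! ### The stochastic problem and its optimal cost -/

/-- The random states `ω t` are i.i.d. with the given distribution, and `x` is a process of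
decisions with `x t` in the decision set of the state `ω t`. -/
structure IsPolicy [MeasurableSpace Ω] {S : Type u} [MeasurableSpace S] (μ : Measure S)
    (ω : ℕ → S → Ω) (x : ℕ → S → Vec I) : Prop where
  prob_measure : IsProbabilityMeasure μ
  state_meas : ∀ t, Measurable (ω t)
  state_law : ∀ t, μ.map (ω t) = P.prob.toMeasure
  state_indep : iIndepFun ω μ
  decision_meas : ∀ t, Measurable (x t)
  decision_mem : ∀ᵐ s ∂μ, ∀ t, x t s ∈ P.X (ω t s)

/-- The time average `(1 / T) ∑_{t < T} E[x t]`. -/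
def meanAvg {S : Type u} [MeasurableSpace S] (μ : Measure S) (x : ℕ → S → Vec I) (T : ℕ) :
    Vec I :=
  (T : ℝ)⁻¹ • ∑ t ∈ Finset.range T, ∫ s, x t s ∂μ

/-- Objective costs of the policies that are feasible for the stochastic problem: minimize
`limsup f (meanAvg T)` subject to `limsup g j (meanAvg T) ≤ 0`. -/
def feasibleCosts [MeasurableSpace Ω] : Set ℝ :=
  {c | ∃ (S : Type u) (_ : MeasurableSpace S) (μ : Measure S) (ω : ℕ → S → Ω)
      (x : ℕ → S → Vec I), P.IsPolicy μ ω x ∧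
      (∀ j, limsup (fun T => P.g j (meanAvg μ x T)) atTop ≤ 0) ∧
      c = limsup (fun T => P.f (meanAvg μ x T)) atTop}

/-- The optimal objective cost of the stochastic problem. -/
def fopt [MeasurableSpace Ω] : ℝ := sInf P.feasibleCosts

/-! ### The dual function -/

/-- The Lagrangian of the embedded problem. -/
def lagrangian (xs : Ω → Vec I) (y : Vec I) (lam : Mult J I) : ℝ :=
  ∑' a, P.wt a * (P.f y + ∑ j, lam.fst j * P.g j y + inner ℝ lam.snd (xs a - y))

/-- The dual function of the embedded problem. -/
def dual (lam : Mult J I) : ℝ :=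
  sInf {r | ∃ (xs : Ω → Vec I) (y : Vec I), (∀ a, xs a ∈ convexHull ℝ (P.X a)) ∧ y ∈ P.Y ∧
    r = P.lagrangian xs y lam}

/-- Optimal solutions of the dual problem: maximize the dual function over `ℝ₊^J × ℝ^I`. -/
def IsDualOptimal (lam : Mult J I) : Prop :=
  (∀ j, 0 ≤ lam.fst j) ∧ ∀ nu : Mult J I, (∀ j, 0 ≤ nu.fst j) → P.dual nu ≤ P.dual lam

/-- `lam` is the unique vector of Lagrange multipliers. -/
def IsUniqueMultiplier (lam : Mult J I) : Prop :=
  P.IsDualOptimal lam ∧ ∀ nu, P.IsDualOptimal nu → nu = lam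

/-- The locally-polyhedral inequality with constant `L > 0`. -/
def IsPolyhedral (lam : Mult J I) (L : ℝ) : Prop :=
  0 < L ∧ ∀ nu : Mult J I, (∀ j, 0 ≤ nu.fst j) →
    P.dual lam ≥ P.dual nu + L * ‖nu - lam‖

/-- `C = sup_{x ∈ bigSet, y ∈ Y} (‖g(y)‖² + ‖x - y‖²) / 2`. -/
def C : ℝ :=
  sSup {r | ∃ x ∈ P.bigSet, ∃ y ∈ P.Y, r = (∑ j, P.g j y ^ 2 + ‖x - y‖ ^ 2) / 2}

end Problem

/-! ### The constants of the steady state -/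

/-- The radius `B_P`. -/
def BP (C L : ℝ) : ℝ := max (L / 2) (2 * C / L)

/-- The exponent `r_P`. -/
def rP (C L : ℝ) : ℝ := 3 * L / (12 * C + L * √(2 * C))

/-- The contraction factor `ρ_P`. -/
def rhoP (C L : ℝ) : ℝ := 1 - rP C L * L / 4

/-- The constant `D_P`. -/
def DP (C L : ℝ) : ℝ :=
  Real.exp (rP C L * BP C L) * (Real.exp (rP C L * √(2 * C)) - rhoP C L) / (1 - rhoP C L)

/-- The constant `U_P`. -/
def UP (C L : ℝ) : ℝ := Real.log (DP C L + Real.exp (rP C L * BP C L)) / rP C L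

/-- The constant `U_P'`. -/
def UP' (C L : ℝ) : ℝ := 2 * (DP C L + Real.exp (rP C L * BP C L)) / rP C L ^ 2

/-! ### The drift-plus-penalty algorithm -/

/-- `x, y, W, Z` are generated by the drift-plus-penalty algorithm with parameter `V`, started at
the constants `(W0, Z0)`, on the i.i.d. states `ω`. The σ-algebra `ℱ t` is the information available
before `ω t` is observed; `ω t` is independent of it, and the decisions of slot `t` (the choice among
several minimizers included) are known at the end of slot `t`. -/
structure IsRun {Ω : Type u} [MeasurableSpace Ω] {I J : ℕ} (P : Problem Ω I J) (V : ℝ)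
    (W0 : Vec J) (Z0 : Vec I) {S : Type v} [mS : MeasurableSpace S] (μ : Measure S)
    (ℱ : Filtration ℕ mS) (ω : ℕ → S → Ω) (x y : ℕ → S → Vec I)
    (W : ℕ → S → Vec J) (Z : ℕ → S → Vec I) : Prop where
  prob_measure : IsProbabilityMeasure μ
  state_meas : ∀ t, Measurable[ℱ (t + 1)] (ω t)
  state_law : ∀ t, μ.map (ω t) = P.prob.toMeasure
  state_indep : ∀ t, Indep (MeasurableSpace.comap (ω t) inferInstance) (ℱ t) μ
  x_meas : ∀ t, Measurable[ℱ (t + 1)] (x t)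
  y_meas : ∀ t, Measurable[ℱ (t + 1)] (y t)
  W0_nonneg : ∀ j, 0 ≤ W0 j
  W_init : ∀ s, W 0 s = W0
  Z_init : ∀ s, Z 0 s = Z0
  x_mem : ∀ t s, x t s ∈ P.X (ω t s)
  x_min : ∀ t s, ∀ x' ∈ P.X (ω t s), inner ℝ (Z t s) (x t s) ≤ inner ℝ (Z t s) x'
  y_mem : ∀ t s, y t s ∈ P.Y
  y_min : ∀ t s, ∀ y' ∈ P.Y,
    V * P.f (y t s) + ∑ j, W t s j * P.g j (y t s) - inner ℝ (Z t s) (y t s)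
      ≤ V * P.f y' + ∑ j, W t s j * P.g j y' - inner ℝ (Z t s) y'
  W_update : ∀ t s j, W (t + 1) s j = max (W t s j + P.g j (y t s)) 0
  Z_update : ∀ t s, Z (t + 1) s = Z t s + x t s - y t s

/-- The first time at which `Q t = (W t, Z t)` is at distance less than `B` from `V • lam`
(`⊤` if there is none). -/
def transientTime {I J : ℕ} (V : ℝ) (lam : Mult J I) (B : ℝ) {S : Type v}
    (W : ℕ → S → Vec J) (Z : ℕ → S → Vec I) (s : S) : ℕ∞ :=
  ⨅ (t : ℕ) (_ : ‖concat (W t s) (Z t s) - V • lam‖ < B), (t : ℕ∞)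

/-- The event `A` belongs to the σ-algebra of the history up to the random time `τ`. -/
def IsPriorEvent {S : Type v} {mS : MeasurableSpace S} (ℱ : Filtration ℕ mS) (τ : S → ℕ∞)
    (A : Set S) : Prop :=
  MeasurableSet A ∧ ∀ n : ℕ, MeasurableSet[ℱ n] (A ∩ {s | τ s ≤ n})

/-- Given the event `A`, the time `t0` is at least `τ`. Both the event (of positive probability) and
the time are determined by the history up to `τ`. The basic instances are: `A` the whole space and
`t0` a constant that is almost surely at least `τ`; `A` the whole space and `t0 = τ`, for an almost
surely finite `τ`; `t0` a constant and `A = {τ ≤ t0}`. -/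
structure IsStart {S : Type v} [mS : MeasurableSpace S] (μ : Measure S) (ℱ : Filtration ℕ mS)
    (τ : S → ℕ∞) (t0 : S → ℕ) (A : Set S) : Prop where
  event : IsPriorEvent ℱ τ A
  pos : μ A ≠ 0
  time : ∀ k : ℕ, IsPriorEvent ℱ τ {s | t0 s = k}
  le : ∀ᵐ s ∂μ, s ∈ A → τ s ≤ t0 s

/-- The average of `x` over the `T` slots that start at `t0`. -/
def windowAvg {I : ℕ} {S : Type v} (x : ℕ → S → Vec I) (t0 : S → ℕ) (T : ℕ) (s : S) : Vec I :=
  (T : ℝ)⁻¹ • ∑ t ∈ Finset.Ico (t0 s) (t0 s + T), x t s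

end DriftPlusPenalty

end

/-! The queue vector `Q = (W, Z)` is a projected stochastic supergradient iterate for the dual: its
increment, before projection, is `drive = (g(y), x - y)`, whose mean given the past is a
supergradient of `dual` at `Q/V`. Since `dual` falls off linearly from its maximum, `‖Q - V • lam‖`
drifts inwards outside the ball of radius `BP`, while each step has length at most `√(2C)`. A
Bernstein-type estimate (`exp_rP_mul_le`, `exp_drift`) turns this into a contraction of `exp (rP *
‖Q - V • lam‖)` by the factor `rhoP`, up to an additive constant. Hence the bound `momentBound`,
which holds on entering the ball, persists (`setIntegral_exp_transientTime_le`,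
`setIntegral_exp_add_le`). It yields first and second moments `UP` and `UP'` that do not depend on
`V`, on the initial queues or on the starting time.

Conditional expectations are avoided. The drift inequalities hold pathwise with an explicit error,
built from `noise = minInner - meanMin` at the realized state; against a bounded `ℱ t`-measurable
weight it integrates to zero (`integral_comp_of_indep`). A random start is cut into the countably
many cells `startCell`, each known at the time when it begins.

Over a window, convexity and the Lipschitz bound replace the average of `x` by averages over `y`, at
a cost given by the increment of `Z`. The sums of `g j` are dominated by increments of `W`, and the
sum of `f` is controlled by telescoping `‖Q‖² / (2V)`. All boundary terms are controlled by
distances from `V • lam`, so they contribute `O(1/T)` in the mean. Weak duality, `dual lam ≤ fopt`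
(`Standing.dual_le_fopt`), finishes the proof. -/

namespace DriftPlusPenalty

namespace Problem

/-! ### Linear minimization over the random decision sets. -/

variable {Ω : Type u} {I J : ℕ} {P : Problem Ω I J}

/-- The minimum of the linear function `x ↦ ⟪z, x⟫` over the decision set of the state `a`. -/
noncomputable def minInner (P : Problem Ω I J) (z : Vec I) (a : Ω) : ℝ :=
  sInf ((fun x => inner ℝ z x) '' P.X a)

/-- The mean of `minInner` over the random state. -/
noncomputable def meanMin (P : Problem Ω I J) (z : Vec I) : ℝ := ∑' a, P.wt a * P.minInner z a

lemma wt_nonneg (P : Problem Ω I J) (a : Ω) : 0 ≤ P.wt a := ENNReal.toReal_nonneg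

lemma hasSum_wt (P : Problem Ω I J) : HasSum P.wt 1 := by
  have h := P.prob.tsum_coe
  have h2 : Summable P.wt := ENNReal.summable_toReal (by rw [h]; simp)
  have h3 : ∑' a, P.wt a = 1 := by
    unfold wt
    rw [← ENNReal.tsum_toReal_eq (fun a => P.prob.apply_ne_top a), h]; simp
  exact h3 ▸ h2.hasSum

lemma summable_wt_mul (P : Problem Ω I J) {u : Ω → ℝ} {K : ℝ} (hu : ∀ a, |u a| ≤ K) :
    Summable fun a => P.wt a * u a := by
  refine Summable.of_norm_bounded (P.hasSum_wt.summable.mul_right K) fun a => ?_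
  rw [Real.norm_eq_abs, abs_mul, abs_of_nonneg (P.wt_nonneg a)]
  exact mul_le_mul_of_nonneg_left (hu a) (P.wt_nonneg a)

lemma summable_wt_smul (P : Problem Ω I J) {u : Ω → Vec I} {K : ℝ} (hu : ∀ a, ‖u a‖ ≤ K) :
    Summable fun a => P.wt a • u a := by
  refine Summable.of_norm_bounded (P.hasSum_wt.summable.mul_right K) fun a => ?_
  rw [norm_smul, Real.norm_eq_abs, abs_of_nonneg (P.wt_nonneg a)]
  exact mul_le_mul_of_nonneg_left (hu a) (P.wt_nonneg a)

lemma tsum_wt_mul_le (P : Problem Ω I J) {u u' : Ω → ℝ} {K K' c : ℝ} (hu : ∀ a, |u a| ≤ K)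
    (hu' : ∀ a, |u' a| ≤ K') (h : ∀ a, u a ≤ u' a + c) :
    ∑' a, P.wt a * u a ≤ ∑' a, P.wt a * u' a + c := by
  have h1 : HasSum (fun a => P.wt a * u' a + P.wt a * c) (∑' a, P.wt a * u' a + 1 * c) :=
    (P.summable_wt_mul hu').hasSum.add (P.hasSum_wt.mul_right c)
  rw [one_mul] at h1
  refine hasSum_le (fun a => ?_) (P.summable_wt_mul hu).hasSum h1
  rw [← mul_add]
  exact mul_le_mul_of_nonneg_left (h a) (P.wt_nonneg a)

/-- A positive bound for the norms of the elements of the big set. -/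
lemma Standing.exists_bound (hP : P.Standing) : ∃ R, 0 < R ∧ ∀ x ∈ P.bigSet, ‖x‖ ≤ R :=
  hP.bigSet_bounded.exists_pos_norm_le

lemma Standing.avgSet_nonempty (hP : P.Standing) : P.avgSet.Nonempty := by
  obtain ⟨x, hx, -⟩ := hP.slater
  exact ⟨x, interior_subset hx⟩

lemma Standing.X_nonempty (hP : P.Standing) (a : Ω) : (P.X a).Nonempty := by
  obtain ⟨_, xs, hxs, -⟩ := hP.avgSet_nonempty
  exact convexHull_nonempty_iff.1 ⟨_, hxs a⟩

lemma Standing.norm_le_of_mem_convexHull (hP : P.Standing) {R : ℝ}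
    (hR : ∀ x ∈ P.bigSet, ‖x‖ ≤ R) {a : Ω} {x : Vec I} (hx : x ∈ convexHull ℝ (P.X a)) :
    ‖x‖ ≤ R := by
  have : convexHull ℝ (P.X a) ⊆ Metric.closedBall 0 R :=
    convexHull_min (fun y hy => by simpa using hR y (hP.X_subset a hy)) (convex_closedBall 0 R)
  simpa using this hx

lemma Standing.exists_minInner (hP : P.Standing) (z : Vec I) (a : Ω) :
    ∃ x ∈ P.X a, inner ℝ z x = P.minInner z a ∧ ∀ x' ∈ P.X a, inner ℝ z x ≤ inner ℝ z x' := by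
  have hc : IsCompact (P.X a) :=
    Metric.isCompact_of_isClosed_isBounded (hP.X_closed a) (hP.X_bounded a)
  obtain ⟨x, hx, hmin⟩ := hc.exists_isMinOn (hP.X_nonempty a) (f := fun x => inner ℝ z x)
    (by fun_prop)
  refine ⟨x, hx, ?_, fun x' hx' => hmin hx'⟩
  have : IsLeast ((fun x => inner ℝ z x) '' P.X a) (inner ℝ z x) :=
    ⟨⟨x, hx, rfl⟩, by rintro _ ⟨y, hy, rfl⟩; exact hmin hy⟩
  exact this.csInf_eq.symm

lemma Standing.minInner_eq (hP : P.Standing) {z : Vec I} {a : Ω} {x : Vec I} (hx : x ∈ P.X a)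
    (hmin : ∀ x' ∈ P.X a, inner ℝ z x ≤ inner ℝ z x') : inner ℝ z x = P.minInner z a := by
  obtain ⟨y, hy, h1, h2⟩ := hP.exists_minInner z a
  exact (le_antisymm (hmin y hy) (h2 x hx)).trans h1

lemma Standing.minInner_le (hP : P.Standing) {z : Vec I} {a : Ω} {x : Vec I}
    (hx : x ∈ convexHull ℝ (P.X a)) : P.minInner z a ≤ inner ℝ z x := by
  obtain ⟨y, hy, h1, h2⟩ := hP.exists_minInner z a
  have : convexHull ℝ (P.X a) ⊆ {x | P.minInner z a ≤ inner ℝ z x} :=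
    convexHull_min (fun x' hx' => h1 ▸ h2 x' hx')
      (convex_halfSpace_ge (f := fun x => inner ℝ z x)
        ⟨fun x y => inner_add_right _ _ _, fun c x => by simp [inner_smul_right]⟩ _)
  exact this hx

lemma Standing.abs_minInner_le (hP : P.Standing) {R : ℝ} (hR : ∀ x ∈ P.bigSet, ‖x‖ ≤ R)
    (z : Vec I) (a : Ω) : |P.minInner z a| ≤ R * ‖z‖ := by
  obtain ⟨y, hy, h1, h2⟩ := hP.exists_minInner z a
  rw [← h1, mul_comm]
  exact (abs_real_inner_le_norm z y).trans
    (mul_le_mul_of_nonneg_left (hR y (hP.X_subset a hy)) (norm_nonneg z))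

/-- A minimizer for `z'` is a competitor for `z`. -/
lemma Standing.minInner_le_add (hP : P.Standing) {R : ℝ} (hR : ∀ x ∈ P.bigSet, ‖x‖ ≤ R)
    (z z' : Vec I) (a : Ω) : P.minInner z a ≤ P.minInner z' a + R * ‖z - z'‖ := by
  obtain ⟨y, hy, h1, h2⟩ := hP.exists_minInner z' a
  have h3 := hP.minInner_le (z := z) (subset_convexHull ℝ _ hy)
  have h4 : inner ℝ z y = inner ℝ z' y + inner ℝ (z - z') y := by rw [inner_sub_left]; ring
  have h5 := (real_inner_le_norm (z - z') y).trans
    (mul_le_mul_of_nonneg_left (hR y (hP.X_subset a hy)) (norm_nonneg (z - z')))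
  linarith [mul_comm R ‖z - z'‖]

lemma Standing.meanMin_le_add (hP : P.Standing) {R : ℝ} (hR : ∀ x ∈ P.bigSet, ‖x‖ ≤ R)
    (z z' : Vec I) : P.meanMin z ≤ P.meanMin z' + R * ‖z - z'‖ :=
  P.tsum_wt_mul_le (hP.abs_minInner_le hR z) (hP.abs_minInner_le hR z')
    (hP.minInner_le_add hR z z')

lemma Standing.abs_meanMin_le (hP : P.Standing) {R : ℝ} (hR : ∀ x ∈ P.bigSet, ‖x‖ ≤ R)
    (z : Vec I) : |P.meanMin z| ≤ R * ‖z‖ := by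
  have h0 : P.meanMin 0 = 0 := by
    have : ∀ a, P.minInner 0 a = 0 := fun a => by
      simpa using hP.abs_minInner_le hR 0 a
    simp [meanMin, this]
  have h1 := hP.meanMin_le_add hR z 0
  have h2 := hP.meanMin_le_add hR 0 z
  rw [h0] at h1 h2
  rw [abs_le]
  simp only [sub_zero, zero_sub, norm_neg] at h1 h2
  constructor <;> linarith

lemma continuous_of_le_add {h : Vec I → ℝ} {R : ℝ} (hR : 0 < R)
    (hh : ∀ z z', h z ≤ h z' + R * ‖z - z'‖) : Continuous h := by
  have : LipschitzWith R.toNNReal h := LipschitzWith.of_dist_le_mul fun z z' => by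
    rw [Real.dist_eq, dist_eq_norm, Real.coe_toNNReal _ hR.le, abs_le]
    have h1 := hh z z'
    have h2 := hh z' z
    rw [norm_sub_rev] at h2
    constructor <;> linarith
  exact this.continuous

lemma Standing.continuous_minInner (hP : P.Standing) (a : Ω) :
    Continuous fun z => P.minInner z a := by
  obtain ⟨R, hR0, hR⟩ := hP.exists_bound
  exact continuous_of_le_add hR0 fun z z' => hP.minInner_le_add hR z z' a

lemma Standing.continuous_meanMin (hP : P.Standing) : Continuous P.meanMin := by
  obtain ⟨R, hR0, hR⟩ := hP.exists_bound
  exact continuous_of_le_add hR0 (hP.meanMin_le_add hR)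

/-! ### The dual function -/

lemma Standing.lagrangian_eq (hP : P.Standing) {xs : Ω → Vec I}
    (hxs : ∀ a, xs a ∈ convexHull ℝ (P.X a)) (y : Vec I) (lam : Mult J I) :
    P.lagrangian xs y lam = P.f y + ∑ j, lam.fst j * P.g j y - inner ℝ lam.snd y
      + ∑' a, P.wt a * inner ℝ lam.snd (xs a) := by
  obtain ⟨R, hR0, hR⟩ := hP.exists_bound
  have hb : ∀ a, |inner ℝ lam.snd (xs a)| ≤ ‖lam.snd‖ * R := fun a =>
    (abs_real_inner_le_norm _ _).trans
      (mul_le_mul_of_nonneg_left (hP.norm_le_of_mem_convexHull hR (hxs a)) (norm_nonneg _))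
  have h1 := (P.hasSum_wt.mul_right (P.f y + ∑ j, lam.fst j * P.g j y - inner ℝ lam.snd y)).add
    (P.summable_wt_mul hb).hasSum
  rw [one_mul] at h1
  rw [← h1.tsum_eq]
  refine tsum_congr fun a => ?_
  rw [inner_sub_right]; ring

lemma Standing.meanMin_le (hP : P.Standing) {xs : Ω → Vec I}
    (hxs : ∀ a, xs a ∈ convexHull ℝ (P.X a)) (z : Vec I) :
    P.meanMin z ≤ ∑' a, P.wt a * inner ℝ z (xs a) := by
  obtain ⟨R, hR0, hR⟩ := hP.exists_bound
  have hb : ∀ a, |inner ℝ z (xs a)| ≤ ‖z‖ * R := fun a =>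
    (abs_real_inner_le_norm _ _).trans
      (mul_le_mul_of_nonneg_left (hP.norm_le_of_mem_convexHull hR (hxs a)) (norm_nonneg _))
  simpa [meanMin] using P.tsum_wt_mul_le (c := 0) (hP.abs_minInner_le hR z) hb
    (fun a => by simpa using hP.minInner_le (hxs a))

lemma Standing.exists_meanMin (hP : P.Standing) (z : Vec I) :
    ∃ xs : Ω → Vec I, (∀ a, xs a ∈ P.X a) ∧ P.meanMin z = ∑' a, P.wt a * inner ℝ z (xs a) := by
  choose xs hxs h1 h2 using hP.exists_minInner z
  exact ⟨xs, hxs, by simp [meanMin, h1]⟩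

/-- The Lagrangian separates into a part in `y` and a part in the `xs`, and the minimum of the
latter is `meanMin`. Together with `dual_le`, this gives all later access to the infimum defining
`dual`. -/
lemma Standing.le_dual (hP : P.Standing) {lam : Mult J I} {c : ℝ}
    (h : ∀ y ∈ P.Y, c ≤ P.f y + ∑ j, lam.fst j * P.g j y - inner ℝ lam.snd y) :
    c + P.meanMin lam.snd ≤ P.dual lam := by
  obtain ⟨v, hv⟩ := hP.avgSet_nonempty
  have hvY := hP.avgSet_subset hv
  obtain ⟨xs, hxs, -⟩ := hv
  refine le_csInf ⟨_, xs, v, hxs, hvY, rfl⟩ ?_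
  rintro _ ⟨xs, y, hxs, hy, rfl⟩
  rw [hP.lagrangian_eq hxs]
  exact add_le_add (h y hy) (hP.meanMin_le hxs _)

/-! ### Bounds and continuous extensions of the objective and the constraints. -/

lemma LipschitzConstants.exists_abs_f_le {Mf : ℝ} {Mg : Fin J → ℝ}
    (hL : P.LipschitzConstants Mf Mg) (hP : P.Standing) :
    ∃ K, ∀ x ∈ P.evalSet, |P.f x| ≤ K := by
  obtain ⟨R, hR0, hR⟩ := hP.exists_bound
  obtain ⟨R', hR0', hR'⟩ := hP.Y_bounded.exists_pos_norm_le
  obtain ⟨v, hv⟩ := hP.avgSet_nonempty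
  have hvE : v ∈ P.evalSet := Or.inl (hP.avgSet_subset hv)
  refine ⟨|P.f v| + Mf * (max R R' + ‖v‖), fun x hx => ?_⟩
  have hxb : ‖x‖ ≤ max R R' := by
    rcases hx with hx | hx
    · exact (hR' x hx).trans (le_max_right _ _)
    · have : convexHull ℝ (⋃ a, P.X a) ⊆ Metric.closedBall 0 R :=
        convexHull_min (Set.iUnion_subset fun a y hy => by
          simpa using hR y (hP.X_subset a hy)) (convex_closedBall 0 R)
      exact (by simpa using this hx : ‖x‖ ≤ R).trans (le_max_left _ _)
  have h1 := hL.f_lip x hx v hvE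
  have h2 : Mf * ‖x - v‖ ≤ Mf * (max R R' + ‖v‖) :=
    mul_le_mul_of_nonneg_left ((norm_sub_le x v).trans (by linarith)) hL.Mf_pos.le
  have h3 := abs_sub_abs_le_abs_sub (P.f x) (P.f v)
  linarith

/-- The same problem with the objective function replaced by one of the constraint functions. -/
def withObjective (P : Problem Ω I J) (j : Fin J) : Problem Ω I J := { P with f := P.g j }

lemma Standing.withObjective (hP : P.Standing) (j : Fin J) : (P.withObjective j).Standing :=
  { hP with f_convex := hP.g_convex j }

lemma LipschitzConstants.withObjective {Mf : ℝ} {Mg : Fin J → ℝ}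
    (hL : P.LipschitzConstants Mf Mg) (j : Fin J) :
    (P.withObjective j).LipschitzConstants (Mg j) Mg :=
  { hL with Mf_pos := hL.Mg_pos j, f_lip := hL.g_lip j }

lemma LipschitzConstants.exists_abs_g_le {Mf : ℝ} {Mg : Fin J → ℝ}
    (hL : P.LipschitzConstants Mf Mg) (hP : P.Standing) (j : Fin J) :
    ∃ K, ∀ x ∈ P.evalSet, |P.g j x| ≤ K :=
  (hL.withObjective j).exists_abs_f_le (hP.withObjective j)

/-- Off `evalSet` the function `f` is arbitrary; measurability along a run comes from this
extension. -/
lemma LipschitzConstants.exists_continuous_f {Mf : ℝ} {Mg : Fin J → ℝ}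
    (hL : P.LipschitzConstants Mf Mg) : ∃ F : Vec I → ℝ, Continuous F ∧ Set.EqOn P.f F P.evalSet := by
  have : LipschitzOnWith Mf.toNNReal P.f P.evalSet := LipschitzOnWith.of_dist_le_mul
    fun x hx y hy => by
      rw [Real.dist_eq, dist_eq_norm, Real.coe_toNNReal _ hL.Mf_pos.le]
      exact hL.f_lip x hx y hy
  obtain ⟨F, hF, h⟩ := this.extend_real
  exact ⟨F, hF.continuous, h⟩

lemma LipschitzConstants.exists_continuous_g {Mf : ℝ} {Mg : Fin J → ℝ}
    (hL : P.LipschitzConstants Mf Mg) (j : Fin J) :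
    ∃ F : Vec I → ℝ, Continuous F ∧ Set.EqOn (P.g j) F P.evalSet :=
  (hL.withObjective j).exists_continuous_f

section

variable {Mf : ℝ} {Mg : Fin J → ℝ}

lemma Standing.bddBelow_lagrangian (hP : P.Standing) (hL : P.LipschitzConstants Mf Mg)
    (lam : Mult J I) :
    BddBelow {r | ∃ (xs : Ω → Vec I) (y : Vec I), (∀ a, xs a ∈ convexHull ℝ (P.X a)) ∧ y ∈ P.Y ∧
      r = P.lagrangian xs y lam} := by
  obtain ⟨K, hK⟩ := hL.exists_abs_f_le hP
  choose Kg hKg using hL.exists_abs_g_le hP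
  obtain ⟨R, hR0, hR⟩ := hP.Y_bounded.exists_pos_norm_le
  refine ⟨-K + ∑ j, -(|lam.fst j| * Kg j) - ‖lam.snd‖ * R + P.meanMin lam.snd, ?_⟩
  rintro _ ⟨xs, y, hxs, hy, rfl⟩
  rw [hP.lagrangian_eq hxs]
  have hyE : y ∈ P.evalSet := Or.inl hy
  have h1 := (abs_le.1 (hK y hyE)).1
  have h2 : ∑ j, -(|lam.fst j| * Kg j) ≤ ∑ j, lam.fst j * P.g j y := by
    refine Finset.sum_le_sum fun j _ => ?_
    have := mul_le_mul_of_nonneg_left (hKg j y hyE) (abs_nonneg (lam.fst j))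
    rw [← abs_mul] at this
    linarith [neg_abs_le (lam.fst j * P.g j y)]
  have h3 := (real_inner_le_norm lam.snd y).trans
    (mul_le_mul_of_nonneg_left (hR y hy) (norm_nonneg lam.snd))
  linarith [hP.meanMin_le hxs lam.snd]

lemma Standing.dual_le (hP : P.Standing) (hL : P.LipschitzConstants Mf Mg) (lam : Mult J I)
    {y : Vec I} (hy : y ∈ P.Y) :
    P.dual lam ≤ P.f y + ∑ j, lam.fst j * P.g j y - inner ℝ lam.snd y + P.meanMin lam.snd := by
  obtain ⟨xs, hxs, h⟩ := hP.exists_meanMin lam.snd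
  have hxs' : ∀ a, xs a ∈ convexHull ℝ (P.X a) := fun a => subset_convexHull ℝ _ (hxs a)
  rw [h, ← hP.lagrangian_eq hxs']
  exact csInf_le (hP.bddBelow_lagrangian hL lam) ⟨xs, y, hxs', hy, rfl⟩

/-! ### The constants -/

lemma Standing.le_C (hP : P.Standing) (hL : P.LipschitzConstants Mf Mg) {x y : Vec I}
    (hx : x ∈ P.bigSet) (hy : y ∈ P.Y) : ∑ j, P.g j y ^ 2 + ‖x - y‖ ^ 2 ≤ 2 * P.C := by
  choose Kg hKg using hL.exists_abs_g_le hP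
  obtain ⟨R, hR0, hR⟩ := hP.exists_bound
  obtain ⟨R', hR0', hR'⟩ := hP.Y_bounded.exists_pos_norm_le
  have hb : BddAbove {r | ∃ x ∈ P.bigSet, ∃ y ∈ P.Y,
      r = (∑ j, P.g j y ^ 2 + ‖x - y‖ ^ 2) / 2} := by
    refine ⟨(∑ j, Kg j ^ 2 + (R + R') ^ 2) / 2, ?_⟩
    rintro _ ⟨x, hx, y, hy, rfl⟩
    have h1 : ∑ j, P.g j y ^ 2 ≤ ∑ j, Kg j ^ 2 := Finset.sum_le_sum fun j _ =>
      sq_le_sq' (by linarith [(abs_le.1 (hKg j y (Or.inl hy))).1])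
        (abs_le.1 (hKg j y (Or.inl hy))).2
    have h2 : ‖x - y‖ ^ 2 ≤ (R + R') ^ 2 := by
      have := (norm_sub_le x y).trans (add_le_add (hR x hx) (hR' y hy))
      gcongr
    linarith
  have := le_csSup hb ⟨x, hx, y, hy, rfl⟩
  change _ ≤ P.C at this
  linarith

lemma Standing.exists_mem_bigSet (hP : P.Standing) : ∃ x, x ∈ P.bigSet := by
  obtain ⟨a, -⟩ := P.prob.support_nonempty
  obtain ⟨x, hx⟩ := hP.X_nonempty a
  exact ⟨x, hP.X_subset a hx⟩

/-- At the Slater point every `g j` is nonzero, and `0 < J` provides at least one of them. -/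
lemma Standing.C_pos (hP : P.Standing) (hL : P.LipschitzConstants Mf Mg) (hJ : 0 < J) :
    0 < P.C := by
  obtain ⟨x, hx⟩ := hP.exists_mem_bigSet
  obtain ⟨y, hy, hneg⟩ := hP.slater
  have h1 := hP.le_C hL hx (hP.avgSet_subset (interior_subset hy))
  have h2 : 0 < ∑ j, P.g j y ^ 2 :=
    Finset.sum_pos (fun j _ => by have := (hneg j).ne; positivity) ⟨⟨0, hJ⟩, Finset.mem_univ _⟩
  nlinarith [sq_nonneg ‖x - y‖]

/-- The vector `(g(y), x - y)` that drives the queues. -/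
noncomputable def drive (P : Problem Ω I J) (x y : Vec I) : Mult J I :=
  concat (WithLp.toLp 2 fun j => P.g j y) (x - y)

lemma norm_drive_sq (P : Problem Ω I J) (x y : Vec I) :
    ‖P.drive x y‖ ^ 2 = ∑ j, P.g j y ^ 2 + ‖x - y‖ ^ 2 := by
  rw [WithLp.prod_norm_sq_eq_of_L2, EuclideanSpace.norm_sq_eq]
  simp [drive, concat]

lemma inner_drive (P : Problem Ω I J) (lam : Mult J I) (x y : Vec I) :
    inner ℝ lam (P.drive x y) = ∑ j, lam.fst j * P.g j y + inner ℝ lam.snd (x - y) := by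
  rw [WithLp.prod_inner_apply]
  simp [drive, concat, PiLp.inner_apply, mul_comm]

lemma Standing.norm_drive_le (hP : P.Standing) (hL : P.LipschitzConstants Mf Mg) {x y : Vec I}
    (hx : x ∈ P.bigSet) (hy : y ∈ P.Y) : ‖P.drive x y‖ ≤ √(2 * P.C) := by
  refine Real.le_sqrt_of_sq_le ?_
  rw [norm_drive_sq]
  exact hP.le_C hL hx hy

/-- For fixed `x` and `y` the Lagrangian is affine in the multiplier with slope `drive x y`, whose
norm is at most `√(2C)`. -/
lemma Standing.dual_le_dual_add (hP : P.Standing) (hL : P.LipschitzConstants Mf Mg)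
    (lam nu : Mult J I) : P.dual lam ≤ P.dual nu + √(2 * P.C) * ‖lam - nu‖ := by
  have key := hP.le_dual (lam := nu)
    (c := P.dual lam - √(2 * P.C) * ‖lam - nu‖ - P.meanMin nu.snd) ?_
  · linarith
  intro y hy
  -- The minimizers are taken in the sets `X a` and not in their hulls: the bound on `drive` needs
  -- points of `bigSet`, which may be non-convex.
  obtain ⟨xs, hxs, h⟩ := hP.exists_meanMin nu.snd
  have h1 := hP.dual_le hL lam hy
  have h2 : P.meanMin lam.snd ≤ ∑' a, P.wt a * inner ℝ lam.snd (xs a) :=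
    hP.meanMin_le (fun a => subset_convexHull ℝ _ (hxs a)) _
  obtain ⟨R, hR0, hR⟩ := hP.exists_bound
  have hb : ∀ (z : Vec I) a, |inner ℝ z (xs a)| ≤ ‖z‖ * R := fun z a =>
    (abs_real_inner_le_norm _ _).trans
      (mul_le_mul_of_nonneg_left (hR _ (hP.X_subset a (hxs a))) (norm_nonneg _))
  have h3 := P.tsum_wt_mul_le (hb lam.snd) (hb nu.snd)
    (c := √(2 * P.C) * ‖lam - nu‖ - ∑ j, (lam.fst j - nu.fst j) * P.g j y
      + inner ℝ (lam.snd - nu.snd) y) fun a => by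
    have e := P.inner_drive (lam - nu) (xs a) y
    have e2 := (real_inner_le_norm (lam - nu) (P.drive (xs a) y)).trans
      (mul_le_mul_of_nonneg_left (hP.norm_drive_le hL (hP.X_subset a (hxs a)) hy)
        (norm_nonneg _))
    simp only [WithLp.sub_fst, WithLp.sub_snd, PiLp.sub_apply, inner_sub_left, inner_sub_right]
      at e e2 ⊢
    linarith
  rw [h]
  simp only [sub_mul, Finset.sum_sub_distrib, inner_sub_left] at h3
  linarith

/-- Along a unit direction `dual` drops by at least `L` and by at most its Lipschitz constant. The
direction is taken in the `z` part, which has no sign constraint. -/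
lemma IsPolyhedral.le_sqrt (hI : 0 < I) (hP : P.Standing) (hL : P.LipschitzConstants Mf Mg)
    {lam : Mult J I} (hlam : ∀ j, 0 ≤ lam.fst j) {L : ℝ} (h : P.IsPolyhedral lam L) :
    L ≤ √(2 * P.C) := by
  set e : Mult J I := concat 0 (EuclideanSpace.single ⟨0, hI⟩ 1) with he
  have hnorm : ‖e‖ = 1 := by
    have : ‖e‖ ^ 2 = 1 := by
      rw [WithLp.prod_norm_sq_eq_of_L2]; simp [he, concat]
    nlinarith [norm_nonneg e]
  have h1 := h.2 (lam + e) (fun j => by simpa [he, concat] using hlam j)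
  have h2 := hP.dual_le_dual_add hL lam (lam + e)
  simp only [add_sub_cancel_left, sub_add_cancel_left, norm_neg, hnorm] at h1 h2
  linarith

end

end Problem

end DriftPlusPenalty

namespace DriftPlusPenalty

/-! ### Independence -/

/-- This plays the role of conditioning on `m`. On each atom `{ω = a}` independence factors the
integral, and the uniform bound `K` allows summing over the countably many states. -/
lemma integral_comp_of_indep {Ω : Type u} [Countable Ω] [MeasurableSpace Ω]
    [MeasurableSingletonClass Ω] {S : Type v} {m mS : MeasurableSpace S} {μ : Measure S}
    [IsProbabilityMeasure μ] (hm : m ≤ mS) {ω : S → Ω} (hω : Measurable ω) {p : PMF Ω}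
    (hlaw : μ.map ω = p.toMeasure) (hind : Indep (MeasurableSpace.comap ω inferInstance) m μ)
    {F : Ω → S → ℝ} {K : ℝ} (hF : ∀ a, Measurable[m] (F a)) (hK : ∀ a s, |F a s| ≤ K) :
    ∫ s, F (ω s) s ∂μ = ∫ s, ∑' a, (p a).toReal * F a s ∂μ := by
  have hF' : ∀ a, Measurable (F a) := fun a => (hF a).mono hm le_rfl
  have hFi : ∀ a, Integrable (F a) μ := fun a =>
    Integrable.of_bound (hF' a).aestronglyMeasurable K (ae_of_all _ (hK a))
  have hset : ∀ a, MeasurableSet (ω ⁻¹' {a}) := fun a => hω (measurableSet_singleton a)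
  have hprob : ∀ a, μ.real (ω ⁻¹' {a}) = (p a).toReal := fun a => by
    rw [measureReal_def, ← Measure.map_apply hω (measurableSet_singleton a), hlaw,
      p.toMeasure_apply_singleton a (measurableSet_singleton a)]
  have hsum : Summable fun a => (p a).toReal :=
    ENNReal.summable_toReal (by rw [p.tsum_coe]; simp)
  have hint : ∀ a, ∫ s, (ω ⁻¹' {a}).indicator (F a) s ∂μ = ∫ s, (p a).toReal * F a s ∂μ := by
    intro a
    have hi : IndepFun (fun s => ({a} : Set Ω).indicator (fun _ => (1 : ℝ)) (ω s)) (F a) μ := by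
      refine indep_of_indep_of_le_left (indep_of_indep_of_le_right hind (hF a).comap_le) ?_
      have h1 : Measurable (({a} : Set Ω).indicator (fun _ => (1 : ℝ))) :=
        measurable_const.indicator (measurableSet_singleton a)
      exact (h1.comp (comap_measurable ω)).comap_le
    have h2 : (fun s => ({a} : Set Ω).indicator (fun _ => (1 : ℝ)) (ω s))
        = (ω ⁻¹' {a}).indicator (fun _ => (1 : ℝ)) := by
      ext s; rfl
    rw [h2] at hi
    have h3 := hi.integral_mul_eq_mul_integral
      (measurable_const.indicator (hset a)).aestronglyMeasurable (hF' a).aestronglyMeasurable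
    rw [integral_indicator_const _ (hset a), hprob, smul_eq_mul, mul_one] at h3
    rw [integral_const_mul, ← h3]
    refine integral_congr_ae (ae_of_all _ fun s => ?_)
    by_cases hs : ω s = a <;> simp [Set.indicator, hs]
  have hA := hasSum_integral_of_summable_integral_norm (μ := μ)
    (F := fun a => (ω ⁻¹' {a}).indicator (F a)) (fun a => (hFi a).indicator (hset a)) <| by
      refine Summable.of_nonneg_of_le (fun a => integral_nonneg fun s => norm_nonneg _)
        (fun a => ?_) (hsum.mul_right K)
      rw [← hprob, ← smul_eq_mul, ← integral_indicator_const _ (hset a)]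
      refine integral_mono ((hFi a).indicator (hset a)).norm
        ((integrable_const K).indicator (hset a)) fun s => ?_
      rw [norm_indicator_eq_indicator_norm]
      exact Set.indicator_le_indicator (hK a s)
  have hB := hasSum_integral_of_summable_integral_norm (μ := μ)
    (F := fun a s => (p a).toReal * F a s) (fun a => (hFi a).const_mul _) <| by
      refine Summable.of_nonneg_of_le (fun a => integral_nonneg fun s => norm_nonneg _)
        (fun a => ?_) (hsum.mul_right K)
      calc ∫ s, ‖(p a).toReal * F a s‖ ∂μ ≤ ∫ s, (p a).toReal * K ∂μ := by
            refine integral_mono ((hFi a).const_mul _).norm (integrable_const _) fun s => ?_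
            rw [norm_mul, Real.norm_of_nonneg ENNReal.toReal_nonneg]
            exact mul_le_mul_of_nonneg_left (hK a s) ENNReal.toReal_nonneg
        _ = _ := by simp
  simp only [hint] at hA
  rw [hB.unique hA]
  refine integral_congr_ae (ae_of_all _ fun s => ?_)
  change F (ω s) s = ∑' a, (ω ⁻¹' {a}).indicator (F a) s
  rw [tsum_eq_single (ω s) fun a ha => by simp [Set.indicator, ha.symm]]
  simp

/-! ### An exponential inequality -/

section Constants

variable {C L : ℝ}

lemma rP_pos (hC : 0 < C) (hL : 0 < L) : 0 < rP C L := by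
  unfold rP; positivity

/-- Keeps the exponents in the range of `exp_le_quadratic`; it reduces to `5 L ≤ 6 √(2C)`. -/
lemma rP_mul_sqrt_le (hC : 0 < C) (hL : 0 < L) (hLC : L ≤ √(2 * C)) :
    rP C L * √(2 * C) ≤ 1 / 2 := by
  have hs : √(2 * C) ^ 2 = 2 * C := Real.sq_sqrt (by positivity)
  have h0 : 0 < √(2 * C) := by positivity
  unfold rP
  rw [div_mul_eq_mul_div, div_le_iff₀ (by positivity)]
  nlinarith

lemma rhoP_lt_one (hC : 0 < C) (hL : 0 < L) : rhoP C L < 1 := by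
  have := rP_pos hC hL
  unfold rhoP
  have : 0 < rP C L * L / 4 := by positivity
  linarith

lemma rhoP_nonneg (hC : 0 < C) (hL : 0 < L) (hLC : L ≤ √(2 * C)) : 0 ≤ rhoP C L := by
  have h1 := rP_mul_sqrt_le hC hL hLC
  have h2 := mul_le_mul_of_nonneg_left hLC (rP_pos hC hL).le
  unfold rhoP
  linarith

lemma one_sub_rhoP_mul_DP (hC : 0 < C) (hL : 0 < L) : (1 - rhoP C L) * DP C L =
    Real.exp (rP C L * BP C L) * (Real.exp (rP C L * √(2 * C)) - rhoP C L) := by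
  have := rhoP_lt_one hC hL
  unfold DP
  field_simp [(sub_pos.2 this).ne']

lemma DP_nonneg (hC : 0 < C) (hL : 0 < L) : 0 ≤ DP C L := by
  have h1 := rhoP_lt_one hC hL
  have h2 : 1 ≤ Real.exp (rP C L * √(2 * C)) :=
    Real.one_le_exp (mul_nonneg (rP_pos hC hL).le (Real.sqrt_nonneg _))
  unfold DP
  refine div_nonneg (mul_nonneg (Real.exp_pos _).le ?_) ?_ <;> linarith

/-- Bernstein's bound: the Taylor tail of the exponential is dominated by a geometric series of
ratio `c / 3`. -/
lemma exp_le_quadratic {x c : ℝ} (hx : |x| ≤ c) (hc : c ≤ 1 / 2) :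
    Real.exp x ≤ 1 + x + c ^ 2 / 2 / (1 - c / 3) := by
  have hc0 : 0 ≤ c := (abs_nonneg x).trans hx
  have h := (abs_le.1 (Real.exp_bound (x := x) (by linarith) (n := 4) (by norm_num))).2
  simp only [Finset.sum_range_succ, Finset.sum_range_zero, Nat.factorial] at h
  norm_num at h
  have h2 : x ^ 2 ≤ c ^ 2 := by rw [← sq_abs x]; gcongr
  have h3 : x ^ 3 ≤ c ^ 3 := by
    refine (le_abs_self _).trans ?_
    rw [abs_pow]; gcongr
  have h4 : |x| ^ 4 ≤ c ^ 4 := by gcongr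
  -- The `c ^ 4` coefficient of the right-hand series is `1/18`, which exceeds the remainder
  -- constant `5/96`.
  have h5 : c ^ 2 / 2 + c ^ 3 / 6 + c ^ 4 * (5 / 96) ≤ c ^ 2 / 2 / (1 - c / 3) := by
    rw [le_div_iff₀ (by linarith)]
    nlinarith [pow_nonneg hc0 4, pow_nonneg hc0 5]
  rw [pow_abs] at h4
  simp only [abs_pow] at h h4
  have h6 : |x| ^ 4 = x ^ 4 := by rw [← abs_pow]; exact abs_of_nonneg (by positivity)
  linarith

/-- This explains the form of `rP`: it makes the quadratic term of Bernstein's bound exactly `rP * L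
/ 4`. Half of the drift `L / 2` pays for that term, and the other half is the gap `1 - rhoP`. -/
lemma exp_rP_mul_le (hC : 0 < C) (hL : 0 < L) (hLC : L ≤ √(2 * C)) {X : ℝ}
    (hX : |X| ≤ √(2 * C)) : Real.exp (rP C L * X) ≤ rhoP C L + rP C L * (X + L / 2) := by
  have hr := rP_pos hC hL
  have h := exp_le_quadratic (x := rP C L * X) (c := rP C L * √(2 * C))
    (by rw [abs_mul, abs_of_pos hr]; gcongr) (rP_mul_sqrt_le hC hL hLC)
  have hs : √(2 * C) ^ 2 = 2 * C := Real.sq_sqrt (by positivity)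
  have h0 : 0 < √(2 * C) := by positivity
  have e : (rP C L * √(2 * C)) ^ 2 / 2 / (1 - rP C L * √(2 * C) / 3) = rP C L * L / 4 := by
    have h1 : 1 - rP C L * √(2 * C) / 3 = 12 * C / (12 * C + L * √(2 * C)) := by
      unfold rP; field_simp; ring
    rw [h1, mul_pow, hs]
    unfold rP; field_simp; ring
  rw [e] at h
  unfold rhoP
  linarith

/-- The weight of the noise in the drift of the exponential Lyapunov function. -/
noncomputable def noiseWeight (C L a : ℝ) : ℝ :=
  if BP C L ≤ a then rP C L * Real.exp (rP C L * a) / a else 0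

/-- The inequality is pathwise, with the noise `n` kept linear and its weight depending on the
present distance `a` alone, so that the noise term can vanish on integration. -/
lemma exp_drift (hC : 0 < C) (hL : 0 < L) (hLC : L ≤ √(2 * C)) {a b n : ℝ}
    (hab : |b - a| ≤ √(2 * C)) (hsq : b ^ 2 ≤ a ^ 2 + 2 * C + 2 * (-L * a + n)) :
    Real.exp (rP C L * b) ≤ rhoP C L * Real.exp (rP C L * a) + (1 - rhoP C L) * DP C L
      + noiseWeight C L a * n := by
  have hr := rP_pos hC hL
  have hρ := rhoP_lt_one hC hL
  have hD := mul_nonneg (sub_pos.2 hρ).le (DP_nonneg hC hL)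
  have hsplit : Real.exp (rP C L * b) = Real.exp (rP C L * a) * Real.exp (rP C L * (b - a)) := by
    rw [← Real.exp_add]; congr 1; ring
  unfold noiseWeight
  split_ifs with h
  · have ha1 : L / 2 ≤ a := (le_max_left _ _).trans h
    have ha2 : 2 * C / L ≤ a := (le_max_right _ _).trans h
    have ha : 0 < a := by linarith
    rw [div_le_iff₀ hL] at ha2
    -- Here `2 * a * (b - a) ≤ b ^ 2 - a ^ 2`, and `2 * C ≤ L * a` absorbs the constant at the cost
    -- of half of the drift.
    have h1 : b - a + L / 2 ≤ n / a := by
      rw [le_div_iff₀ ha]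
      nlinarith [sq_nonneg (b - a)]
    have h2 := exp_rP_mul_le hC hL hLC hab
    have h3 := mul_le_mul_of_nonneg_left h1 hr.le
    calc Real.exp (rP C L * b)
        ≤ Real.exp (rP C L * a) * (rhoP C L + rP C L * (n / a)) := by
          rw [hsplit]; gcongr; linarith
      _ = rhoP C L * Real.exp (rP C L * a) + rP C L * Real.exp (rP C L * a) / a * n := by ring
      _ ≤ _ := by linarith
  · push Not at h
    -- Inside the ball no drift is available; `DP` is designed to pay for a largest possible outward
    -- step.
    rw [one_sub_rhoP_mul_DP hC hL, zero_mul, add_zero]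
    have h1 : Real.exp (rP C L * (b - a)) ≤ Real.exp (rP C L * √(2 * C)) := by
      gcongr; exact (abs_le.1 hab).2
    have h2 : Real.exp (rP C L * a) ≤ Real.exp (rP C L * BP C L) := by gcongr
    have h3 : 1 ≤ Real.exp (rP C L * √(2 * C)) :=
      Real.one_le_exp (mul_nonneg hr.le (Real.sqrt_nonneg _))
    have h4 := mul_le_mul_of_nonneg_right h2
      (by linarith : 0 ≤ Real.exp (rP C L * √(2 * C)) - rhoP C L)
    have h5 := mul_le_mul_of_nonneg_left h1 (Real.exp_pos (rP C L * a)).le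
    rw [hsplit]
    linarith

/-- The bound for the exponential moments of the distance from the attractor. -/
noncomputable def momentBound (C L : ℝ) : ℝ := DP C L + Real.exp (rP C L * BP C L)

/-- Any constant at least `DP` is preserved by the recursion. The extra exponential in `momentBound`
covers the moment of entry into the ball. -/
lemma momentBound_step (hC : 0 < C) (hL : 0 < L) :
    rhoP C L * momentBound C L + (1 - rhoP C L) * DP C L ≤ momentBound C L := by
  have hρ := rhoP_lt_one hC hL
  have h := mul_nonneg (sub_pos.2 hρ).le (Real.exp_pos (rP C L * BP C L)).le
  unfold momentBound
  linarith

lemma exp_le_momentBound (hC : 0 < C) (hL : 0 < L) {a : ℝ} (ha : a < BP C L) :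
    Real.exp (rP C L * a) ≤ momentBound C L := by
  have h1 : Real.exp (rP C L * a) ≤ Real.exp (rP C L * BP C L) := by
    have := rP_pos hC hL
    gcongr
  have := DP_nonneg hC hL
  unfold momentBound
  linarith

lemma one_le_momentBound (hC : 0 < C) (hL : 0 < L) : 1 ≤ momentBound C L := by
  have h1 : 1 ≤ Real.exp (rP C L * BP C L) := Real.one_le_exp <|
    mul_nonneg (rP_pos hC hL).le ((by positivity : 0 ≤ L / 2).trans (le_max_left _ _))
  have := DP_nonneg hC hL
  unfold momentBound
  linarith

lemma UP_nonneg (hC : 0 < C) (hL : 0 < L) : 0 ≤ UP C L :=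
  div_nonneg (Real.log_nonneg (one_le_momentBound hC hL)) (rP_pos hC hL).le

lemma UP'_nonneg (hC : 0 < C) (hL : 0 < L) : 0 ≤ UP' C L :=
  div_nonneg (mul_nonneg zero_le_two (zero_le_one.trans (one_le_momentBound hC hL)))
    (sq_nonneg _)

end Constants

/-! ### One slot of the algorithm -/

namespace Problem

variable {Ω : Type u} {I J : ℕ} {P : Problem Ω I J}

/-- The deviation of `minInner` from its mean. -/
noncomputable def noise (P : Problem Ω I J) (z : Vec I) (a : Ω) : ℝ :=
  P.minInner z a - P.meanMin z

lemma Standing.abs_noise_le (hP : P.Standing) {R : ℝ} (hR : ∀ x ∈ P.bigSet, ‖x‖ ≤ R)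
    (z : Vec I) (a : Ω) : |P.noise z a| ≤ 2 * R * ‖z‖ := by
  have := abs_sub (P.minInner z a) (P.meanMin z)
  have h1 := hP.abs_minInner_le hR z a
  have h2 := hP.abs_meanMin_le hR z
  unfold noise
  linarith

/-- With `z` and `ψ` frozen by the past, averaging `minInner` over the state gives `meanMin`, so the
noise has mean zero. -/
lemma Standing.integral_mul_noise [Countable Ω] [MeasurableSpace Ω]
    [MeasurableSingletonClass Ω] (hP : P.Standing) {S : Type v} {m mS : MeasurableSpace S}
    {μ : Measure S} [IsProbabilityMeasure μ] (hm : m ≤ mS) {ω : S → Ω} (hω : Measurable ω)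
    (hlaw : μ.map ω = P.prob.toMeasure)
    (hind : Indep (MeasurableSpace.comap ω inferInstance) m μ) {ψ : S → ℝ} {z : S → Vec I}
    (hψ : Measurable[m] ψ) (hz : Measurable[m] z) {K K' : ℝ} (hK : ∀ s, |ψ s| ≤ K)
    (hK' : ∀ s, ‖z s‖ ≤ K') : ∫ s, ψ s * P.noise (z s) (ω s) ∂μ = 0 := by
  obtain ⟨R, hR0, hR⟩ := hP.exists_bound
  have h := integral_comp_of_indep hm hω hlaw hind
    (F := fun a s => ψ s * P.noise (z s) a) (K := K * (2 * R * K'))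
    (fun a => hψ.mul (((hP.continuous_minInner a).measurable.comp hz).sub
      (hP.continuous_meanMin.measurable.comp hz))) fun a s => by
      rw [abs_mul]
      refine mul_le_mul (hK s) ((hP.abs_noise_le hR _ _).trans ?_) (abs_nonneg _)
        ((abs_nonneg _).trans (hK s))
      exact mul_le_mul_of_nonneg_left (hK' s) (by positivity)
  rw [h]
  have : ∀ s, ∑' a, (P.prob a).toReal * (ψ s * P.noise (z s) a) = 0 := by
    intro s
    have h1 : HasSum (fun a => P.wt a * P.minInner (z s) a - P.wt a * P.meanMin (z s))
        (P.meanMin (z s) - 1 * P.meanMin (z s)) :=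
      (P.summable_wt_mul (hP.abs_minInner_le hR (z s))).hasSum.sub (P.hasSum_wt.mul_right _)
    have h2 := (h1.mul_left (ψ s)).tsum_eq
    rw [one_mul, sub_self, mul_zero] at h2
    rw [← h2]
    refine tsum_congr fun a => ?_
    change P.wt a * _ = _
    unfold noise; ring
  simp [this]

lemma measurable_apply_of_countable [Countable Ω] [MeasurableSpace Ω]
    [MeasurableSingletonClass Ω] {S : Type v} [MeasurableSpace S] {β : Type*} [MeasurableSpace β]
    {ω : S → Ω} (hω : Measurable ω) {F : Ω → S → β} (h : ∀ a, Measurable (F a)) : Measurable fun s => F (ω s) s := by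
  have : Measurable (Function.uncurry F) := measurable_from_prod_countable_right h
  exact this.comp (hω.prodMk measurable_id)

lemma Standing.measurable_noise [Countable Ω] [MeasurableSpace Ω] [MeasurableSingletonClass Ω]
    (hP : P.Standing) {S : Type v} [MeasurableSpace S] {ω : S → Ω} (hω : Measurable ω)
    {z : S → Vec I} (hz : Measurable z) : Measurable fun s => P.noise (z s) (ω s) :=
  measurable_apply_of_countable hω (F := fun a s => P.noise (z s) a) fun a =>
    ((hP.continuous_minInner a).measurable.comp hz).sub (hP.continuous_meanMin.measurable.comp hz)

/-! ### Queue updates and the drift towards the scaled multiplier. -/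

/-- The update `Q ↦ Q'` of the queues in a slot with decisions `x` and `y`. -/
structure IsUpdate (P : Problem Ω I J) (x y : Vec I) (Q Q' : Mult J I) : Prop where
  nonneg : ∀ j, 0 ≤ Q.fst j
  fst : ∀ j, Q'.fst j = max (Q.fst j + P.g j y) 0
  snd : Q'.snd = Q.snd + x - y

/-- The positive part is 1-Lipschitz and fixes the nonnegative coordinates of `p`. It is used with
`p` equal to `Q`, to `V • lam` and to `0`. -/
lemma IsUpdate.norm_sub_le {x y : Vec I} {Q Q' : Mult J I} (h : P.IsUpdate x y Q Q')
    {p : Mult J I} (hp : ∀ j, 0 ≤ p.fst j) : ‖Q' - p‖ ≤ ‖Q - p + P.drive x y‖ := by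
  rw [← pow_le_pow_iff_left₀ (norm_nonneg _) (norm_nonneg _) two_ne_zero,
    WithLp.prod_norm_sq_eq_of_L2, WithLp.prod_norm_sq_eq_of_L2, EuclideanSpace.norm_sq_eq (Q' - p).fst,
    EuclideanSpace.norm_sq_eq (Q - p + P.drive x y).fst]
  have e : (Q - p + P.drive x y).snd = (Q' - p).snd := by
    simp only [WithLp.add_snd, WithLp.sub_snd, h.snd]
    change Q.snd - p.snd + (x - y) = _
    abel
  rw [e]
  refine add_le_add (Finset.sum_le_sum fun j _ => pow_le_pow_left₀ (norm_nonneg _) ?_ 2) le_rfl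
  have e2 : (Q - p + P.drive x y).fst j = Q.fst j - p.fst j + P.g j y := rfl
  have e3 : (Q' - p).fst j = max (Q.fst j + P.g j y) 0 - p.fst j := by
    rw [← h.fst]; rfl
  rw [e2, e3, Real.norm_eq_abs, Real.norm_eq_abs]
  have e4 : p.fst j = max (p.fst j) 0 := (max_eq_left (hp j)).symm
  rw [e4]
  refine (abs_max_sub_max_le_abs _ _ _).trans (le_of_eq ?_)
  rw [← e4]
  congr 1; ring

/-- One slot of the algorithm, in the state `a`. -/
structure IsSlot (P : Problem Ω I J) (V : ℝ) (a : Ω) (x y : Vec I) (Q Q' : Mult J I) : Prop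
    extends P.IsUpdate x y Q Q' where
  x_mem : x ∈ P.X a
  x_min : ∀ x' ∈ P.X a, inner ℝ Q.snd x ≤ inner ℝ Q.snd x'
  y_mem : y ∈ P.Y
  y_min : ∀ y' ∈ P.Y, V * P.f y + ∑ j, Q.fst j * P.g j y - inner ℝ Q.snd y
      ≤ V * P.f y' + ∑ j, Q.fst j * P.g j y' - inner ℝ Q.snd y'

section Slot

variable {Mf : ℝ} {Mg : Fin J → ℝ} {V : ℝ} {a : Ω} {x y : Vec I} {Q Q' lam : Mult J I} {L : ℝ}

lemma IsSlot.norm_sub_self_le (h : P.IsSlot V a x y Q Q') (hP : P.Standing)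
    (hL : P.LipschitzConstants Mf Mg) : ‖Q' - Q‖ ≤ √(2 * P.C) := by
  have h1 := h.norm_sub_le h.nonneg
  rw [sub_self, zero_add] at h1
  exact h1.trans (hP.norm_drive_le hL (hP.X_subset a h.x_mem) h.y_mem)

lemma IsSlot.abs_norm_sub_le (h : P.IsSlot V a x y Q Q') (hP : P.Standing)
    (hL : P.LipschitzConstants Mf Mg) (p : Mult J I) :
    |‖Q' - p‖ - ‖Q - p‖| ≤ √(2 * P.C) := by
  have h1 := abs_norm_sub_norm_le (Q' - p) (Q - p)
  rw [sub_sub_sub_cancel_right] at h1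
  exact h1.trans (h.norm_sub_self_le hP hL)

lemma IsSlot.norm_sub_sq_le (h : P.IsSlot V a x y Q Q') (hP : P.Standing)
    (hL : P.LipschitzConstants Mf Mg) {p : Mult J I} (hp : ∀ j, 0 ≤ p.fst j) :
    ‖Q' - p‖ ^ 2 ≤ ‖Q - p‖ ^ 2 + 2 * P.C + 2 * inner ℝ (Q - p) (P.drive x y) := by
  have h1 := pow_le_pow_left₀ (norm_nonneg _) (h.norm_sub_le hp) 2
  rw [norm_add_sq_real] at h1
  have h2 := P.norm_drive_sq x y
  have h3 := hP.le_C hL (hP.X_subset a h.x_mem) h.y_mem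
  linarith

/-- The decisions minimize the Lagrangian at `Q / V`, except that `x` sees the realized state
instead of the mean; this is the noise. The polyhedral inequality at `Q / V` then supplies the
negative drift. -/
lemma IsSlot.penalty_add_inner_le (h : P.IsSlot V a x y Q Q') (hP : P.Standing) (hV : 0 < V)
    (hlam : P.IsPolyhedral lam L) :
    V * P.f y + inner ℝ Q (P.drive x y)
      ≤ V * P.dual lam - L * ‖Q - V • lam‖ + V * P.noise (V⁻¹ • Q).snd a := by
  have e1 : ∀ y', P.f y' + ∑ j, (V⁻¹ • Q).fst j * P.g j y' - inner ℝ (V⁻¹ • Q).snd y'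
      = V⁻¹ * (V * P.f y' + ∑ j, Q.fst j * P.g j y' - inner ℝ Q.snd y') := fun y' => by
    simp only [WithLp.smul_fst, WithLp.smul_snd, PiLp.smul_apply, smul_eq_mul,
      real_inner_smul_left, mul_add, mul_sub, Finset.mul_sum]
    simp only [mul_assoc]
    field_simp
  have h1 := hP.le_dual (lam := V⁻¹ • Q)
    (c := V⁻¹ * (V * P.f y + ∑ j, Q.fst j * P.g j y - inner ℝ Q.snd y)) fun y' hy' => by
      rw [e1]
      exact mul_le_mul_of_nonneg_left (h.y_min y' hy') (by positivity)
  have h2 := hlam.2 (V⁻¹ • Q) fun j => by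
    have := h.nonneg j
    simp only [WithLp.smul_fst, PiLp.smul_apply, smul_eq_mul]; positivity
  have h3 : inner ℝ (V⁻¹ • Q).snd x = P.minInner (V⁻¹ • Q).snd a := by
    refine hP.minInner_eq h.x_mem fun x' hx' => ?_
    simp only [WithLp.smul_snd, real_inner_smul_left]
    exact mul_le_mul_of_nonneg_left (h.x_min x' hx') (by positivity)
  have h4 : ‖V⁻¹ • Q - lam‖ = V⁻¹ * ‖Q - V • lam‖ := by
    have : V⁻¹ • Q - lam = V⁻¹ • (Q - V • lam) := by rw [smul_sub, inv_smul_smul₀ hV.ne']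
    rw [this, norm_smul, Real.norm_of_nonneg (by positivity : 0 ≤ V⁻¹)]
  rw [h4] at h2
  have h5 : inner ℝ Q.snd x = V * P.minInner (V⁻¹ • Q).snd a := by
    rw [← h3, WithLp.smul_snd, real_inner_smul_left, mul_inv_cancel_left₀ hV.ne']
  have h6 := mul_le_mul_of_nonneg_left (h1.trans (le_sub_iff_add_le.2 h2)) hV.le
  rw [mul_add, mul_inv_cancel_left₀ hV.ne', mul_sub, mul_left_comm V L, mul_inv_cancel_left₀ hV.ne']
    at h6
  rw [inner_drive, inner_sub_right, h5]
  unfold noise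
  linarith

/-- The opposite bound at a fixed multiplier, where `x` and `y` are mere competitors. -/
lemma Standing.dual_add_noise_le (hP : P.Standing) (hL : P.LipschitzConstants Mf Mg)
    (lam : Mult J I) (hx : x ∈ P.X a) (hy : y ∈ P.Y) :
    P.dual lam + P.noise lam.snd a ≤ P.f y + inner ℝ lam (P.drive x y) := by
  have h1 := hP.dual_le hL lam hy
  have h2 := hP.minInner_le (z := lam.snd) (subset_convexHull ℝ _ hx)
  rw [inner_drive, inner_sub_right]
  unfold noise
  linarith

/-- The noise in the drift of the distance from the attractor. -/
noncomputable def driftNoise (P : Problem Ω I J) (V : ℝ) (lam Q : Mult J I) (a : Ω) : ℝ :=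
  V * P.noise (V⁻¹ • Q).snd a - V * P.noise lam.snd a

/-- Subtracting the two preceding bounds cancels `V * f y` and leaves a noisy supergradient
inequality. -/
lemma IsSlot.inner_sub_le (h : P.IsSlot V a x y Q Q') (hP : P.Standing)
    (hL : P.LipschitzConstants Mf Mg) (hV : 0 < V) (hlam : P.IsPolyhedral lam L) :
    inner ℝ (Q - V • lam) (P.drive x y) ≤ -L * ‖Q - V • lam‖ + P.driftNoise V lam Q a := by
  have h1 := h.penalty_add_inner_le hP hV hlam
  have h2 := mul_le_mul_of_nonneg_left (hP.dual_add_noise_le hL lam h.x_mem h.y_mem) hV.le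
  rw [inner_sub_left, real_inner_smul_left]
  unfold driftNoise
  linarith

lemma IsSlot.exp_le (h : P.IsSlot V a x y Q Q') (hP : P.Standing)
    (hL : P.LipschitzConstants Mf Mg) (hI : 0 < I) (hJ : 0 < J) (hV : 0 < V)
    (hnonneg : ∀ j, 0 ≤ lam.fst j) (hlam : P.IsPolyhedral lam L) :
    Real.exp (rP P.C L * ‖Q' - V • lam‖)
      ≤ rhoP P.C L * Real.exp (rP P.C L * ‖Q - V • lam‖) + (1 - rhoP P.C L) * DP P.C L
        + noiseWeight P.C L ‖Q - V • lam‖ * P.driftNoise V lam Q a := by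
  refine exp_drift (hP.C_pos hL hJ) hlam.1 (hlam.le_sqrt hI hP hL hnonneg)
    (h.abs_norm_sub_le hP hL _) ?_
  have h1 := h.norm_sub_sq_le hP hL (p := V • lam) fun j => by
    have := hnonneg j
    simp only [WithLp.smul_fst, PiLp.smul_apply, smul_eq_mul]; positivity
  have h2 := h.inner_sub_le hP hL hV hlam
  linarith

end Slot

end Problem

end DriftPlusPenalty

namespace DriftPlusPenalty

/-! ### Exponential moments along a run -/

lemma measurable_noiseWeight (C L : ℝ) : Measurable (noiseWeight C L) :=
  Measurable.ite measurableSet_Ici (by fun_prop) measurable_const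

lemma abs_noiseWeight_le {C L : ℝ} (hC : 0 < C) (hL : 0 < L) {a K : ℝ} (ha : a ≤ K) :
    |noiseWeight C L a| ≤ rP C L * Real.exp (rP C L * K) / BP C L := by
  have hr := rP_pos hC hL
  have hB : 0 < BP C L := (half_pos hL).trans_le (le_max_left _ _)
  unfold noiseWeight
  split_ifs with h
  · have ha0 : 0 < a := hB.trans_le h
    rw [abs_of_nonneg (by positivity)]
    gcongr
  · rw [abs_zero]; positivity

lemma transientTime_le_iff {I J : ℕ} {V : ℝ} {lam : Mult J I} {B : ℝ} {S : Type v}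
    {W : ℕ → S → Vec J} {Z : ℕ → S → Vec I} {s : S} {n : ℕ} :
    transientTime V lam B W Z s ≤ n ↔ ∃ m ≤ n, ‖concat (W m s) (Z m s) - V • lam‖ < B := by
  unfold transientTime
  rw [← ENat.lt_add_one_iff (ENat.natCast_ne_top n)]
  simp only [iInf_lt_iff]
  constructor
  · rintro ⟨m, h, hm⟩
    refine ⟨m, ?_, h⟩
    have : m < n + 1 := by exact_mod_cast hm
    omega
  · rintro ⟨m, hm, h⟩
    exact ⟨m, h, by exact_mod_cast Nat.lt_succ_of_le hm⟩

lemma IsPriorEvent.inter {S : Type v} {mS : MeasurableSpace S} {ℱ : Filtration ℕ mS}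
    {τ : S → ℕ∞} {A A' : Set S} (h : IsPriorEvent ℱ τ A) (h' : IsPriorEvent ℱ τ A') :
    IsPriorEvent ℱ τ (A ∩ A') :=
  ⟨h.1.inter h'.1, fun n => by
    rw [Set.inter_inter_distrib_right]
    exact (h.2 n).inter (h'.2 n)⟩

lemma norm_le_norm_concat {I J : ℕ} (w : Vec J) (z : Vec I) : ‖z‖ ≤ ‖concat w z‖ := by
  have h := WithLp.prod_norm_sq_eq_of_L2 (concat w z)
  have h2 : (concat w z).snd = z := rfl
  rw [h2] at h
  exact le_of_sq_le_sq (by nlinarith [sq_nonneg ‖(concat w z).fst‖]) (norm_nonneg _)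

lemma measurable_toLp_of_forall {J : ℕ} {S : Type v} {m : MeasurableSpace S}
    {F : S → Fin J → ℝ} (h : ∀ j, Measurable fun s => F s j) :
    Measurable fun s => (WithLp.toLp 2 (F s) : Vec J) :=
  (WithLp.measurable_toLp 2 _).comp (measurable_pi_lambda _ h)

namespace IsRun

variable {Ω : Type u} [MeasurableSpace Ω] {I J : ℕ}
  {P : Problem Ω I J} {V : ℝ} {W0 : Vec J} {Z0 : Vec I} {S : Type v} {mS : MeasurableSpace S}
  {μ : Measure S} {ℱ : Filtration ℕ mS} {ω : ℕ → S → Ω} {x y : ℕ → S → Vec I}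
  {W : ℕ → S → Vec J} {Z : ℕ → S → Vec I} {Mf : ℝ} {Mg : Fin J → ℝ} {lam : Mult J I} {L : ℝ}

/-! ### Measurability and deterministic bounds along a run. -/

lemma W_nonneg (h : IsRun P V W0 Z0 μ ℱ ω x y W Z) (t : ℕ) (s : S) (j : Fin J) :
    0 ≤ W t s j := by
  cases t with
  | zero => rw [h.W_init]; exact h.W0_nonneg j
  | succ t => rw [h.W_update]; exact le_max_right _ _

lemma isSlot (h : IsRun P V W0 Z0 μ ℱ ω x y W Z) (t : ℕ) (s : S) :
    P.IsSlot V (ω t s) (x t s) (y t s) (concat (W t s) (Z t s))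
      (concat (W (t + 1) s) (Z (t + 1) s)) where
  nonneg := h.W_nonneg t s
  fst := h.W_update t s
  snd := h.Z_update t s
  x_mem := h.x_mem t s
  x_min := h.x_min t s
  y_mem := h.y_mem t s
  y_min := h.y_min t s

lemma measurable_queue (h : IsRun P V W0 Z0 μ ℱ ω x y W Z)
    (hL : P.LipschitzConstants Mf Mg) (t : ℕ) :
    Measurable[ℱ t] (W t) ∧ Measurable[ℱ t] (Z t) := by
  induction t with
  | zero =>
    have h1 : W 0 = fun _ => W0 := funext h.W_init
    have h2 : Z 0 = fun _ => Z0 := funext h.Z_init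
    rw [h1, h2]
    exact ⟨measurable_const, measurable_const⟩
  | succ t ih =>
    have hle := ℱ.mono t.le_succ
    have hW : Measurable[ℱ (t + 1)] (W t) := ih.1.mono hle le_rfl
    have hZ : Measurable[ℱ (t + 1)] (Z t) := ih.2.mono hle le_rfl
    have hx := h.x_meas t
    have hy := h.y_meas t
    constructor
    · have h1 : W (t + 1) = fun s =>
          (WithLp.toLp 2 fun j => max (W t s j + P.g j (y t s)) 0 : Vec J) := by
        ext s j; exact h.W_update t s j
      rw [h1]
      refine measurable_toLp_of_forall fun j => ?_
      obtain ⟨F, hF, hFg⟩ := hL.exists_continuous_g j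
      have h2 : (fun s => P.g j (y t s)) = fun s => F (y t s) :=
        funext fun s => hFg (Or.inl (h.y_mem t s))
      have h3 : Measurable[ℱ (t + 1)] fun s => P.g j (y t s) := by
        rw [h2]; exact hF.measurable.comp hy
      have h4 : Measurable[ℱ (t + 1)] fun s => W t s j :=
        (EuclideanSpace.proj (𝕜 := ℝ) j).continuous.measurable.comp hW
      exact (h4.add h3).max measurable_const
    · have h1 : Z (t + 1) = fun s => Z t s + x t s - y t s := funext (h.Z_update t)
      rw [h1]
      let := ℱ (t + 1)
      exact (hZ.add hx).sub hy

lemma measurable_dist (h : IsRun P V W0 Z0 μ ℱ ω x y W Z)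
    (hL : P.LipschitzConstants Mf Mg) (p : Mult J I) (t : ℕ) :
    Measurable[ℱ t] fun s => ‖concat (W t s) (Z t s) - p‖ := by
  obtain ⟨hW, hZ⟩ := h.measurable_queue hL t
  have h1 : (fun s => ‖concat (W t s) (Z t s) - p‖)
      = fun s => √(‖W t s - p.fst‖ ^ 2 + ‖Z t s - p.snd‖ ^ 2) := by
    ext s
    rw [WithLp.prod_norm_eq_of_L2]; rfl
  rw [h1]
  let := ℱ t
  fun_prop

/-- The start is constant and the steps are bounded. At each fixed time this makes the quantities to
be integrated bounded. -/
lemma dist_le (h : IsRun P V W0 Z0 μ ℱ ω x y W Z) (hP : P.Standing)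
    (hL : P.LipschitzConstants Mf Mg) (p : Mult J I) (t : ℕ) (s : S) :
    ‖concat (W t s) (Z t s) - p‖ ≤ ‖concat W0 Z0 - p‖ + t * √(2 * P.C) := by
  induction t with
  | zero => rw [h.W_init, h.Z_init]; simp
  | succ t ih =>
    have := (abs_le.1 ((h.isSlot t s).abs_norm_sub_le hP hL p)).2
    push_cast
    linarith

lemma integrable_exp (h : IsRun P V W0 Z0 μ ℱ ω x y W Z) (hP : P.Standing)
    (hL : P.LipschitzConstants Mf Mg) (p : Mult J I) {r : ℝ} (hr : 0 ≤ r) (t : ℕ) :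
    Integrable (fun s => Real.exp (r * ‖concat (W t s) (Z t s) - p‖)) μ := by
  have := h.prob_measure
  have hm := (h.measurable_dist hL p t).mono (ℱ.le t) le_rfl
  refine Integrable.of_bound (hm.const_mul r).exp.aestronglyMeasurable
    (Real.exp (r * (‖concat W0 Z0 - p‖ + t * √(2 * P.C)))) (ae_of_all _ fun s => ?_)
  rw [Real.norm_of_nonneg (Real.exp_pos _).le]
  have := h.dist_le hP hL p t s
  gcongr

lemma measurable_scaled (h : IsRun P V W0 Z0 μ ℱ ω x y W Z)
    (hL : P.LipschitzConstants Mf Mg) (t : ℕ) :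
    Measurable[ℱ t] fun s => (V⁻¹ • concat (W t s) (Z t s)).snd := by
  have hZ := (h.measurable_queue hL t).2
  change Measurable[ℱ t] fun s => V⁻¹ • Z t s
  let := ℱ t
  fun_prop

lemma norm_scaled_le (h : IsRun P V W0 Z0 μ ℱ ω x y W Z) (hP : P.Standing)
    (hL : P.LipschitzConstants Mf Mg) (hV : 0 < V) (t : ℕ) (s : S) :
    ‖(V⁻¹ • concat (W t s) (Z t s)).snd‖ ≤ V⁻¹ * (‖concat W0 Z0‖ + t * √(2 * P.C)) := by
  have h1 := h.dist_le hP hL 0 t s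
  rw [sub_zero, sub_zero] at h1
  rw [WithLp.smul_snd, norm_smul, Real.norm_of_nonneg (by positivity : 0 ≤ V⁻¹)]
  exact mul_le_mul_of_nonneg_left ((norm_le_norm_concat _ _).trans h1) (by positivity)

variable [Countable Ω] [MeasurableSingletonClass Ω]

/-! ### Propagation of exponential moments. -/

lemma integral_mul_noise (h : IsRun P V W0 Z0 μ ℱ ω x y W Z) (hP : P.Standing) (t : ℕ)
    {ψ : S → ℝ} {z : S → Vec I} (hψ : Measurable[ℱ t] ψ) (hz : Measurable[ℱ t] z) {K K' : ℝ}
    (hK : ∀ s, |ψ s| ≤ K) (hK' : ∀ s, ‖z s‖ ≤ K') :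
    ∫ s, ψ s * P.noise (z s) (ω t s) ∂μ = 0 :=
  have := h.prob_measure
  hP.integral_mul_noise (ℱ.le t) ((h.state_meas t).mono (ℱ.le _) le_rfl) (h.state_law t)
    (h.state_indep t) hψ hz hK hK'

lemma measurable_noise (h : IsRun P V W0 Z0 μ ℱ ω x y W Z) (hP : P.Standing) (t : ℕ)
    {z : S → Vec I} (hz : Measurable z) : Measurable fun s => P.noise (z s) (ω t s) :=
  hP.measurable_noise ((h.state_meas t).mono (ℱ.le _) le_rfl) hz

lemma integrable_mul_noise (h : IsRun P V W0 Z0 μ ℱ ω x y W Z) (hP : P.Standing) (t : ℕ)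
    {ψ : S → ℝ} {z : S → Vec I} (hψ : Measurable[ℱ t] ψ) (hz : Measurable[ℱ t] z) {K K' : ℝ}
    (hK : ∀ s, |ψ s| ≤ K) (hK' : ∀ s, ‖z s‖ ≤ K') :
    Integrable (fun s => ψ s * P.noise (z s) (ω t s)) μ := by
  have := h.prob_measure
  obtain ⟨R, hR0, hR⟩ := hP.exists_bound
  refine Integrable.of_bound ((hψ.mono (ℱ.le t) le_rfl).mul
    (h.measurable_noise hP t (hz.mono (ℱ.le t) le_rfl))).aestronglyMeasurable
    (K * (2 * R * K')) (ae_of_all _ fun s => ?_)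
  rw [Real.norm_eq_abs, abs_mul]
  refine mul_le_mul (hK s) ((hP.abs_noise_le hR _ _).trans ?_) (abs_nonneg _)
    ((abs_nonneg _).trans (hK s))
  exact mul_le_mul_of_nonneg_left (hK' s) (by positivity)

/-- The indicator of `G` and the weight are both known at time `t`, so their product is an
admissible bounded multiplier of the noise. -/
lemma setIntegral_noiseWeight_mul (h : IsRun P V W0 Z0 μ ℱ ω x y W Z) (hP : P.Standing)
    (hL : P.LipschitzConstants Mf Mg) (hJ : 0 < J) (hV : 0 < V) (hL0 : 0 < L) (t : ℕ)
    {G : Set S} (hG : MeasurableSet[ℱ t] G) :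
    IntegrableOn (fun s => noiseWeight P.C L ‖concat (W t s) (Z t s) - V • lam‖
      * P.driftNoise V lam (concat (W t s) (Z t s)) (ω t s)) G μ ∧
    ∫ s in G, noiseWeight P.C L ‖concat (W t s) (Z t s) - V • lam‖
      * P.driftNoise V lam (concat (W t s) (Z t s)) (ω t s) ∂μ = 0 := by
  set ψ : S → ℝ := G.indicator fun s =>
    noiseWeight P.C L ‖concat (W t s) (Z t s) - V • lam‖ * V with hψ
  have hψm : Measurable[ℱ t] ψ := by
    have h1 := (measurable_noiseWeight P.C L).comp (h.measurable_dist hL (V • lam) t)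
    let := ℱ t
    exact (h1.mul_const V).indicator hG
  obtain ⟨K, hK⟩ : ∃ K, ∀ s, |ψ s| ≤ K := by
    refine ⟨rP P.C L * Real.exp (rP P.C L *
      (‖concat W0 Z0 - V • lam‖ + t * √(2 * P.C))) / BP P.C L * V, fun s => ?_⟩
    have h1 := mul_le_mul_of_nonneg_right (abs_noiseWeight_le (hP.C_pos hL hJ) hL0
      (h.dist_le hP hL (V • lam) t s)) hV.le
    by_cases hs : s ∈ G
    · rwa [hψ, Set.indicator_of_mem hs, abs_mul, abs_of_pos hV]
    · rw [hψ, Set.indicator_of_notMem hs, abs_zero]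
      exact (mul_nonneg (abs_nonneg _) hV.le).trans h1
  have i1 := h.integrable_mul_noise hP t hψm (h.measurable_scaled hL t) hK
    (h.norm_scaled_le hP hL hV t)
  have i2 := h.integrable_mul_noise hP t hψm (z := fun _ => lam.snd)
    (@measurable_const _ _ _ (ℱ t) _) hK (fun _ => le_rfl)
  have z1 := h.integral_mul_noise hP t hψm (h.measurable_scaled hL t) hK
    (h.norm_scaled_le hP hL hV t)
  have z2 := h.integral_mul_noise hP t hψm (z := fun _ => lam.snd)
    (@measurable_const _ _ _ (ℱ t) _) hK (fun _ => le_rfl)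
  have e : (G.indicator fun s => noiseWeight P.C L ‖concat (W t s) (Z t s) - V • lam‖
      * P.driftNoise V lam (concat (W t s) (Z t s)) (ω t s))
      = fun s => ψ s * P.noise (V⁻¹ • concat (W t s) (Z t s)).snd (ω t s)
        - ψ s * P.noise lam.snd (ω t s) := by
    ext s
    by_cases hs : s ∈ G
    · rw [hψ, Set.indicator_of_mem hs, Set.indicator_of_mem hs]
      unfold Problem.driftNoise; ring
    · rw [hψ, Set.indicator_of_notMem hs, Set.indicator_of_notMem hs]
      ring
  have hG' := ℱ.le t G hG
  rw [← integrable_indicator_iff hG', ← integral_indicator hG', e]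
  exact ⟨i1.sub i2, by rw [integral_sub i1 i2, z1, z2, sub_zero]⟩

/-- Working on an arbitrary event known at time `t` replaces a conditional estimate; the event stays
known later, so the step iterates. -/
lemma setIntegral_exp_succ_le (h : IsRun P V W0 Z0 μ ℱ ω x y W Z) (hP : P.Standing)
    (hL : P.LipschitzConstants Mf Mg) (hI : 0 < I) (hJ : 0 < J) (hV : 0 < V)
    (hnonneg : ∀ j, 0 ≤ lam.fst j) (hlam : P.IsPolyhedral lam L) (t : ℕ)
    {G : Set S} (hG : MeasurableSet[ℱ t] G)
    (hle : ∫ s in G, Real.exp (rP P.C L * ‖concat (W t s) (Z t s) - V • lam‖) ∂μ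
      ≤ momentBound P.C L * μ.real G) :
    ∫ s in G, Real.exp (rP P.C L * ‖concat (W (t + 1) s) (Z (t + 1) s) - V • lam‖) ∂μ
      ≤ momentBound P.C L * μ.real G := by
  have := h.prob_measure
  have hC := hP.C_pos hL hJ
  have hr := rP_pos hC hlam.1
  have hρ := rhoP_nonneg hC hlam.1 (hlam.le_sqrt hI hP hL hnonneg)
  obtain ⟨i3, z3⟩ := h.setIntegral_noiseWeight_mul hP hL hJ hV hlam.1 (lam := lam) t hG
  have i1 := ((h.integrable_exp hP hL (V • lam) hr.le t).integrableOn (s := G)).const_mul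
    (rhoP P.C L)
  have i2 : IntegrableOn (fun _ : S => (1 - rhoP P.C L) * DP P.C L) G μ := integrable_const _
  have key := integral_mono
    (h.integrable_exp hP hL (V • lam) hr.le (t + 1)).integrableOn
    ((i1.add i2).add i3)
    (fun s => (h.isSlot t s).exp_le hP hL hI hJ hV hnonneg hlam)
  rw [integral_add' (i1.add i2) i3, z3, integral_add' i1 i2, integral_const_mul, integral_const,
    measureReal_restrict_apply_univ, smul_eq_mul] at key
  have h1 := mul_le_mul_of_nonneg_left hle hρ
  have h2 := mul_le_mul_of_nonneg_right (momentBound_step hC hlam.1)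
    (measureReal_nonneg (μ := μ) (s := G))
  linarith

lemma setIntegral_exp_add_le (h : IsRun P V W0 Z0 μ ℱ ω x y W Z) (hP : P.Standing)
    (hL : P.LipschitzConstants Mf Mg) (hI : 0 < I) (hJ : 0 < J) (hV : 0 < V)
    (hnonneg : ∀ j, 0 ≤ lam.fst j) (hlam : P.IsPolyhedral lam L) (t i : ℕ)
    {G : Set S} (hG : MeasurableSet[ℱ t] G)
    (hle : ∫ s in G, Real.exp (rP P.C L * ‖concat (W t s) (Z t s) - V • lam‖) ∂μ
      ≤ momentBound P.C L * μ.real G) :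
    ∫ s in G, Real.exp (rP P.C L * ‖concat (W (t + i) s) (Z (t + i) s) - V • lam‖) ∂μ
      ≤ momentBound P.C L * μ.real G := by
  induction i with
  | zero => exact hle
  | succ i ih =>
    exact h.setIntegral_exp_succ_le hP hL hI hJ hV hnonneg hlam (t + i)
      (ℱ.mono (Nat.le_add_right t i) G hG) ih

/-- Induction on `n`: where the transient ended by time `n`, the bound is carried one slot further;
on the new part the queue is inside the ball at time `n + 1`, and the bound holds pointwise. -/
lemma setIntegral_exp_transientTime_le (h : IsRun P V W0 Z0 μ ℱ ω x y W Z) (hP : P.Standing)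
    (hL : P.LipschitzConstants Mf Mg) (hI : 0 < I) (hJ : 0 < J) (hV : 0 < V)
    (hnonneg : ∀ j, 0 ≤ lam.fst j) (hlam : P.IsPolyhedral lam L) {E : Set S}
    (hE : IsPriorEvent ℱ (transientTime V lam (BP P.C L) W Z) E) (n : ℕ) :
    ∫ s in E ∩ {s | transientTime V lam (BP P.C L) W Z s ≤ n},
        Real.exp (rP P.C L * ‖concat (W n s) (Z n s) - V • lam‖) ∂μ
      ≤ momentBound P.C L * μ.real (E ∩ {s | transientTime V lam (BP P.C L) W Z s ≤ n}) := by
  have := h.prob_measure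
  have hC := hP.C_pos hL hJ
  have hr := rP_pos hC hlam.1
  have small : ∀ (n : ℕ) (G : Set S), MeasurableSet G →
      (∀ s ∈ G, ‖concat (W n s) (Z n s) - V • lam‖ < BP P.C L) →
      ∫ s in G, Real.exp (rP P.C L * ‖concat (W n s) (Z n s) - V • lam‖) ∂μ
        ≤ momentBound P.C L * μ.real G := by
    intro n G hG hlt
    have := setIntegral_mono_on (μ := μ)
      (h.integrable_exp hP hL (V • lam) hr.le n).integrableOn
      (integrableOn_const (C := momentBound P.C L)) hG
      (fun s hs => exp_le_momentBound hC hlam.1 (hlt s hs))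
    rwa [setIntegral_const, smul_eq_mul, mul_comm] at this
  induction n with
  | zero =>
    refine small 0 _ (ℱ.le 0 _ (hE.2 0)) fun s hs => ?_
    obtain ⟨m, hm, hlt⟩ := transientTime_le_iff.1 hs.2
    obtain rfl : m = 0 := by omega
    exact hlt
  | succ n ih =>
    set G1 := E ∩ {s | transientTime V lam (BP P.C L) W Z s ≤ n}
    set G2 := E ∩ {s | transientTime V lam (BP P.C L) W Z s ≤ (n + 1 : ℕ)}
    have m1 := ℱ.le n _ (hE.2 n)
    have m2 := ℱ.le (n + 1) _ (hE.2 (n + 1))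
    have hsub : G1 ⊆ G2 := Set.inter_subset_inter_right _ fun s hs =>
      le_trans (α := ℕ∞) hs (by exact_mod_cast n.le_succ)
    have hsplit : G2 = G1 ∪ G2 \ G1 := (Set.union_sdiff_cancel hsub).symm
    have hdisj : Disjoint G1 (G2 \ G1) := Set.disjoint_sdiff_right
    have hi := h.integrable_exp hP hL (V • lam) hr.le (n + 1)
    have h1 := h.setIntegral_exp_succ_le hP hL hI hJ hV hnonneg hlam n (hE.2 n) ih
    have h2 := small (n + 1) (G2 \ G1) (m2.diff m1) fun s hs => by
      obtain ⟨m, hm, hlt⟩ := transientTime_le_iff.1 hs.1.2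
      rcases Nat.lt_or_ge m (n + 1) with hm' | hm'
      · exact absurd ⟨hs.1.1, transientTime_le_iff.2 ⟨m, by omega, hlt⟩⟩ hs.2
      · obtain rfl : m = n + 1 := by omega
        exact hlt
    rw [hsplit, setIntegral_union hdisj (m2.diff m1) hi.integrableOn hi.integrableOn,
      measureReal_union hdisj (m2.diff m1), mul_add]
    exact add_le_add h1 h2

end IsRun

end DriftPlusPenalty

namespace DriftPlusPenalty

namespace Problem

variable {Ω : Type u} {I J : ℕ} {P : Problem Ω I J} {Mf : ℝ} {Mg : Fin J → ℝ}

/-! ### Weak duality for the stochastic problem -/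

lemma Standing.inner_tsum_wt_smul (hP : P.Standing) {xs : Ω → Vec I}
    (hxs : ∀ a, xs a ∈ convexHull ℝ (P.X a)) (z : Vec I) :
    inner ℝ z (∑' a, P.wt a • xs a) = ∑' a, P.wt a * inner ℝ z (xs a) := by
  obtain ⟨R, hR0, hR⟩ := hP.exists_bound
  have h := P.summable_wt_smul fun a => hP.norm_le_of_mem_convexHull hR (hxs a)
  have h1 := (innerSL ℝ z).hasSum h.hasSum
  simp only [innerSL_apply_apply, inner_smul_right] at h1
  exact h1.tsum_eq.symm

/-- A hyperplane separating `m` from `Y` with normal `z` would also separate it from the mean of the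
minimizers for `z`, which lies in `avgSet` and hence in `Y`. -/
lemma Standing.mem_Y_of_meanMin_le (hP : P.Standing) {m : Vec I}
    (hm : ∀ z, P.meanMin z ≤ inner ℝ z m) : m ∈ P.Y := by
  by_contra hmY
  obtain ⟨φ, c, h1, h2⟩ := geometric_hahn_banach_point_closed hP.Y_convex hP.Y_closed hmY
  set z := (InnerProductSpace.toDual ℝ (Vec I)).symm φ with hz
  have hφ : ∀ v, φ v = inner ℝ z v := fun v => by
    rw [hz, InnerProductSpace.toDual_symm_apply]
  obtain ⟨xs, hxs, h⟩ := hP.exists_meanMin z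
  have hxs' : ∀ a, xs a ∈ convexHull ℝ (P.X a) := fun a => subset_convexHull ℝ _ (hxs a)
  have h3 := h2 _ (hP.avgSet_subset ⟨xs, hxs', rfl⟩)
  rw [hφ, hP.inner_tsum_wt_smul hxs', ← h] at h3
  rw [hφ] at h1
  linarith [hm z]

lemma IsPolicy.meanMin_le_inner_integral [Countable Ω] [MeasurableSpace Ω]
    [MeasurableSingletonClass Ω] {S : Type u} [MeasurableSpace S] {μ : Measure S}
    {ω : ℕ → S → Ω} {x : ℕ → S → Vec I} (h : P.IsPolicy μ ω x) (hP : P.Standing) (t : ℕ)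
    (z : Vec I) : P.meanMin z ≤ inner ℝ z (∫ s, x t s ∂μ) := by
  have := h.prob_measure
  obtain ⟨R, hR0, hR⟩ := hP.exists_bound
  have hxi : Integrable (x t) μ := by
    refine Integrable.of_bound (h.decision_meas t).aestronglyMeasurable R ?_
    filter_upwards [h.decision_mem] with s hs
    exact hR _ (hP.X_subset _ (hs t))
  -- The integrand depends on the state alone, so the trivial σ-algebra suffices.
  have h1 := integral_comp_of_indep (μ := μ) bot_le (h.state_meas t) (h.state_law t)
    (indep_bot_right _) (F := fun a _ => P.minInner z a) (fun a => measurable_const)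
    (fun a _ => hP.abs_minInner_le hR z a)
  rw [integral_const, probReal_univ, one_smul] at h1
  have h2 : Integrable (fun s => P.minInner z (ω t s)) μ := by
    refine Integrable.of_bound (measurable_apply_of_countable (h.state_meas t)
      (F := fun a _ => P.minInner z a) fun a => measurable_const).aestronglyMeasurable
      (R * ‖z‖) (ae_of_all _ fun s => hP.abs_minInner_le hR z _)
  have h3 : inner ℝ z (∫ s, x t s ∂μ) = ∫ s, inner ℝ z (x t s) ∂μ :=
    (integral_inner hxi z).symm
  rw [h3]
  refine h1.symm.le.trans (integral_mono_ae h2 (hxi.const_inner z) ?_)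
  filter_upwards [h.decision_mem] with s hs
  exact hP.minInner_le (subset_convexHull ℝ _ (hs t))

lemma IsPolicy.meanMin_le_inner_meanAvg [Countable Ω] [MeasurableSpace Ω]
    [MeasurableSingletonClass Ω] {S : Type u} [MeasurableSpace S] {μ : Measure S}
    {ω : ℕ → S → Ω} {x : ℕ → S → Vec I} (h : P.IsPolicy μ ω x) (hP : P.Standing) {T : ℕ}
    (hT : 0 < T) (z : Vec I) : P.meanMin z ≤ inner ℝ z (meanAvg μ x T) := by
  have hT' : (0 : ℝ) < T := by exact_mod_cast hT
  unfold meanAvg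
  rw [inner_smul_right, inner_sum]
  have : ∑ t ∈ Finset.range T, P.meanMin z ≤ ∑ t ∈ Finset.range T, inner ℝ z (∫ s, x t s ∂μ) :=
    Finset.sum_le_sum fun t _ => h.meanMin_le_inner_integral hP t z
  rw [Finset.sum_const, Finset.card_range, nsmul_eq_mul] at this
  rw [inv_mul_eq_div, le_div_iff₀ hT']
  linarith

lemma isBoundedUnder_of_abs_le {F : Vec I → ℝ} {m : ℕ → Vec I} {K : ℝ}
    (h : ∀ T, 0 < T → |F (m T)| ≤ K) : IsBoundedUnder (· ≤ ·) atTop fun T => F (m T) :=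
  ⟨K, by
    rw [eventually_map]
    filter_upwards [eventually_gt_atTop 0] with T hT
    exact (abs_le.1 (h T hT)).2⟩

/-- The mean averages of a policy are feasible points `y` that cannot beat `meanMin`, so `dual_le`
applies to them. At some late time the constraints hold up to `ε`, and `ε` tends to zero. -/
lemma Standing.dual_le_of_mem_feasibleCosts [Countable Ω] [MeasurableSpace Ω]
    [MeasurableSingletonClass Ω] (hP : P.Standing) (hL : P.LipschitzConstants Mf Mg)
    {lam : Mult J I} (hlam : ∀ j, 0 ≤ lam.fst j) {c : ℝ} (hc : c ∈ P.feasibleCosts) :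
    P.dual lam ≤ c := by
  obtain ⟨S, mS, μ, ω, x, hpol, hg, rfl⟩ := hc
  -- For `T = 0` the average is the zero vector, which may lie outside `Y`.
  have hY : ∀ T, 0 < T → meanAvg μ x T ∈ P.Y := fun T hT =>
    hP.mem_Y_of_meanMin_le (hpol.meanMin_le_inner_meanAvg hP hT)
  have hdual : ∀ T, 0 < T → P.dual lam ≤ P.f (meanAvg μ x T)
      + ∑ j, lam.fst j * P.g j (meanAvg μ x T) := fun T hT => by
    linarith [hP.dual_le hL lam (hY T hT), hpol.meanMin_le_inner_meanAvg hP hT lam.snd]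
  obtain ⟨K, hK⟩ := hL.exists_abs_f_le hP
  choose Kg hKg using hL.exists_abs_g_le hP
  have key : ∀ ε : ℝ, 0 < ε → P.dual lam
      ≤ limsup (fun T => P.f (meanAvg μ x T)) atTop + ε * (1 + ∑ j, lam.fst j) := by
    intro ε hε
    have e1 : ∀ᶠ T in atTop, P.f (meanAvg μ x T)
        < limsup (fun T => P.f (meanAvg μ x T)) atTop + ε :=
      eventually_lt_of_limsup_lt (by linarith)
        (isBoundedUnder_of_abs_le fun T hT => hK _ (Or.inl (hY T hT)))
    have e2 : ∀ᶠ T in atTop, ∀ j, P.g j (meanAvg μ x T) < ε :=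
      eventually_all.2 fun j => eventually_lt_of_limsup_lt ((hg j).trans_lt hε)
        (isBoundedUnder_of_abs_le fun T hT => hKg j _ (Or.inl (hY T hT)))
    obtain ⟨T, h1, h2, hT⟩ := (e1.and (e2.and (eventually_gt_atTop 0))).exists
    have h3 : ∑ j, lam.fst j * P.g j (meanAvg μ x T) ≤ ∑ j, lam.fst j * ε :=
      Finset.sum_le_sum fun j _ => mul_le_mul_of_nonneg_left (h2 j).le (hlam j)
    rw [← Finset.sum_mul] at h3
    linarith [hdual T hT]
  have hs : 0 < 1 + ∑ j, lam.fst j := by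
    have := Finset.sum_nonneg fun j (_ : j ∈ Finset.univ) => hlam j
    linarith
  refine le_of_forall_pos_le_add fun ε hε => ?_
  have := key (ε / (1 + ∑ j, lam.fst j)) (by positivity)
  rwa [div_mul_cancel₀ _ hs.ne'] at this

/-! ### Feasibility of the stochastic problem -/

lemma exists_measure_of_mem_convexHull {X : Set (Vec I)} {v : Vec I} (hv : v ∈ convexHull ℝ X) :
    ∃ κ : Measure (Vec I), IsProbabilityMeasure κ ∧ (∀ᵐ y ∂κ, y ∈ X) ∧ ∫ y, y ∂κ = v := by
  obtain ⟨ι, _, w, z, hw, hw1, hz, rfl⟩ := mem_convexHull_iff_exists_fintype.1 hv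
  refine ⟨∑ i, ENNReal.ofReal (w i) • Measure.dirac (z i), ⟨?_⟩, ?_, ?_⟩
  · simp only [Measure.coe_finsetSum, Measure.coe_smul, Finset.sum_apply, Pi.smul_apply,
      measure_univ, smul_eq_mul, mul_one]
    rw [← ENNReal.ofReal_sum_of_nonneg fun i _ => hw i, hw1, ENNReal.ofReal_one]
  · rw [ae_iff, Measure.coe_finsetSum, Finset.sum_apply]
    refine Finset.sum_eq_zero fun i _ => ?_
    rw [Measure.smul_apply, smul_eq_mul]
    have : ∀ᵐ y ∂Measure.dirac (z i), y ∈ X := by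
      rw [ae_dirac_eq]; exact hz i
    rw [ae_iff.1 this, mul_zero]
  · rw [integral_finsetSum_measure fun i _ =>
      (integrable_dirac (by simp)).smul_measure ENNReal.ofReal_ne_top]
    refine Finset.sum_congr rfl fun i _ => ?_
    rw [integral_smul_measure, integral_dirac, ENNReal.toReal_ofReal (hw i)]

/-- Needed because `fopt` is a real infimum, whose value on the empty set says nothing. The Slater
point is the mean of an i.i.d. policy that randomizes within each `X a` to reach the required point
of its hull. -/
lemma Standing.feasibleCosts_nonempty [Countable Ω] [MeasurableSpace Ω]
    [MeasurableSingletonClass Ω] (hP : P.Standing) : P.feasibleCosts.Nonempty := by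
  obtain ⟨v, hv, hneg⟩ := hP.slater
  obtain ⟨xs, hxs, rfl⟩ := interior_subset hv
  choose κ hκ1 hκ2 hκ3 using fun a => exists_measure_of_mem_convexHull (hxs a)
  let k : Kernel Ω (Vec I) := Kernel.ofFunOfCountable κ
  have hk : IsMarkovKernel k := ⟨hκ1⟩
  obtain ⟨R, hR0, hR⟩ := hP.exists_bound
  set ν : Measure (Ω × Vec I) := P.prob.toMeasure ⊗ₘ k with hν
  have hmem : ∀ᵐ p ∂ν, p.2 ∈ P.X p.1 := by
    have hms : MeasurableSet {p : Ω × Vec I | p.2 ∈ P.X p.1} := by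
      have : {p : Ω × Vec I | p.2 ∈ P.X p.1} = ⋃ a, {a} ×ˢ P.X a := by
        ext p; simp
      rw [this]
      exact MeasurableSet.iUnion fun a =>
        (measurableSet_singleton a).prod (hP.X_closed a).measurableSet
    rw [hν, Measure.ae_compProd_iff hms]
    exact ae_of_all _ hκ2
  have hint : Integrable (fun p : Ω × Vec I => p.2) ν := by
    refine Integrable.of_bound measurable_snd.aestronglyMeasurable R ?_
    filter_upwards [hmem] with p hp
    exact hR _ (hP.X_subset _ hp)
  have hmean : ∫ p, p.2 ∂ν = ∑' a, P.wt a • xs a := by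
    rw [hν, Measure.integral_compProd hint]
    have : ∀ a, ∫ y, y ∂(k a) = xs a := hκ3
    simp only [this]
    refine PMF.integral_eq_tsum _ _ (Integrable.of_bound
      (measurable_from_top.mono (fun s _ => s.to_countable.measurableSet)
        le_rfl).aestronglyMeasurable R
      (ae_of_all _ fun a => hP.norm_le_of_mem_convexHull hR (hxs a)))
  let μ : Measure (ℕ → Ω × Vec I) := Measure.infinitePi fun _ => ν
  have hmp : ∀ t, MeasurePreserving (Function.eval t) μ ν := fun t =>
    measurePreserving_eval_infinitePi (fun _ => ν) t
  have hx : ∀ t, ∫ s, (s t).2 ∂μ = ∑' a, P.wt a • xs a := fun t => by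
    rw [← hmean, ← (hmp t).map_eq]
    exact (integral_map (hmp t).aemeasurable measurable_snd.aestronglyMeasurable).symm
  have hav : ∀ T : ℕ, 0 < T →
      meanAvg μ (fun t s => (s t).2) T = ∑' a, P.wt a • xs a := fun T hT => by
    have hT' : (T : ℝ) ≠ 0 := by exact_mod_cast hT.ne'
    unfold meanAvg
    simp only [hx]
    rw [Finset.sum_const, Finset.card_range, ← Nat.cast_smul_eq_nsmul ℝ, inv_smul_smul₀ hT']
  refine ⟨_, ℕ → Ω × Vec I, inferInstance, μ, fun t s => (s t).1, fun t s => (s t).2, ?_, ?_,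
    rfl⟩
  · refine ⟨inferInstance, fun t => by fun_prop, fun t => ?_, ?_, fun t => by fun_prop, ?_⟩
    · change μ.map (Prod.fst ∘ Function.eval t) = _
      rw [← Measure.map_map measurable_fst (hmp t).measurable, (hmp t).map_eq]
      exact Measure.fst_compProd _ _
    · exact iIndepFun_infinitePi (fun _ => measurable_fst)
    · exact ae_all_iff.2 fun t => (hmp t).quasiMeasurePreserving.ae hmem
  · intro j
    have : (fun T => P.g j (meanAvg μ (fun t s => (s t).2) T))
        =ᶠ[atTop] fun _ => P.g j (∑' a, P.wt a • xs a) := by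
      filter_upwards [eventually_gt_atTop 0] with T hT
      rw [hav T hT]
    rw [limsup_congr this, limsup_const]
    exact (hneg j).le

lemma Standing.dual_le_fopt [Countable Ω] [MeasurableSpace Ω] [MeasurableSingletonClass Ω]
    (hP : P.Standing) (hL : P.LipschitzConstants Mf Mg) {lam : Mult J I}
    (hlam : ∀ j, 0 ≤ lam.fst j) : P.dual lam ≤ P.fopt :=
  le_csInf hP.feasibleCosts_nonempty fun _ hc => hP.dual_le_of_mem_feasibleCosts hL hlam hc

end Problem

end DriftPlusPenalty

namespace DriftPlusPenalty

/-! ### Random starting times -/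

section Start

variable {S : Type v} {mS : MeasurableSpace S} {μ : Measure S} {ℱ : Filtration ℕ mS}
  {τ : S → ℕ∞} {t0 : S → ℕ} {A : Set S}

/-- The part of the event `A` in which the starting time is `k` and the transient is over. -/
def startCell (τ : S → ℕ∞) (t0 : S → ℕ) (A : Set S) (k : ℕ) : Set S :=
  A ∩ {s | t0 s = k} ∩ {s | τ s ≤ k}

lemma IsStart.measurable_time (h : IsStart μ ℱ τ t0 A) : Measurable t0 :=
  measurable_to_countable' fun k => (h.time k).1

lemma IsStart.measurableSet_startCell (h : IsStart μ ℱ τ t0 A) (k : ℕ) :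
    MeasurableSet[ℱ k] (startCell τ t0 A k) :=
  (h.event.inter (h.time k)).2 k

lemma pairwise_disjoint_startCell :
    Pairwise (Function.onFun Disjoint (startCell τ t0 A)) := fun _ _ hij =>
  Set.disjoint_left.2 fun _ hs hs' => hij (hs.1.2.symm.trans hs'.1.2)

/-- The cells exhaust `A` up to a null set because the start is almost surely after the transient.
-/
lemma IsStart.cond_eq (h : IsStart μ ℱ τ t0 A) :
    μ[|A] = (μ (⋃ k, startCell τ t0 A k))⁻¹ • μ.restrict (⋃ k, startCell τ t0 A k) := by
  have hae : A =ᵐ[μ] (⋃ k, startCell τ t0 A k : Set S) := by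
    filter_upwards [h.le] with s hs
    refine propext ⟨fun hA => Set.mem_iUnion.2 ⟨t0 s, ⟨hA, rfl⟩, hs hA⟩, fun hU => ?_⟩
    obtain ⟨k, hk⟩ := Set.mem_iUnion.1 hU
    exact hk.1.1
  rw [ProbabilityTheory.cond, measure_congr hae, Measure.restrict_congr_set hae]

lemma IsStart.measure_iUnion_ne_zero (h : IsStart μ ℱ τ t0 A) :
    μ (⋃ k, startCell τ t0 A k) ≠ 0 := by
  have hsub : A ≤ᵐ[μ] (⋃ k, startCell τ t0 A k : Set S) := by
    filter_upwards [h.le] with s hs hA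
    exact Set.mem_iUnion.2 ⟨t0 s, ⟨hA, rfl⟩, hs hA⟩
  exact fun h0 => h.pos (le_antisymm (h0 ▸ measure_mono_ae hsub) zero_le)

lemma IsStart.measurable_shift (h : IsStart μ ℱ τ t0 A) {β : Type*} [MeasurableSpace β]
    {F : ℕ → S → β} (hF : ∀ n, Measurable (F n)) (i : ℕ) : Measurable fun s => F (t0 s + i) s :=
  Problem.measurable_apply_of_countable h.measurable_time (F := fun k s => F (k + i) s)
    fun k => hF (k + i)

/-- No uniform bound holds over the infinitely many possible starts, so the cells are summed with
the Lebesgue integral, which yields integrability and the bound together. -/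
lemma IsStart.integrable_shift_of_nonneg [IsProbabilityMeasure μ] (h : IsStart μ ℱ τ t0 A)
    {F : ℕ → S → ℝ} (hF : ∀ n, Measurable (F n)) (hF0 : ∀ n s, 0 ≤ F n s) {M : ℝ} (hM : 0 ≤ M)
    (i : ℕ) (hint : ∀ n, Integrable (F n) μ)
    (hle : ∀ k, ∫ s in startCell τ t0 A k, F (k + i) s ∂μ ≤ M * μ.real (startCell τ t0 A k)) :
    Integrable (fun s => F (t0 s + i) s) μ[|A] ∧ ∫ s, F (t0 s + i) s ∂μ[|A] ≤ M := by
  have hms : ∀ k, MeasurableSet (startCell τ t0 A k) := fun k =>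
    ℱ.le k _ (h.measurableSet_startCell k)
  have hl : ∫⁻ s, ENNReal.ofReal (F (t0 s + i) s) ∂μ[|A] ≤ ENNReal.ofReal M := by
    rw [h.cond_eq, lintegral_smul_measure, lintegral_iUnion hms pairwise_disjoint_startCell]
    have h1 : ∀ k, ∫⁻ s in startCell τ t0 A k, ENNReal.ofReal (F (t0 s + i) s) ∂μ
        ≤ ENNReal.ofReal M * μ (startCell τ t0 A k) := fun k => by
      rw [setLIntegral_congr_fun (g := fun s => ENNReal.ofReal (F (k + i) s)) (hms k)
        fun s hs => by rw [show t0 s = k from hs.1.2],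
        ← ofReal_integral_eq_lintegral_ofReal (hint _).integrableOn (ae_of_all _ (hF0 _))]
      refine (ENNReal.ofReal_le_ofReal (hle k)).trans (le_of_eq ?_)
      rw [ENNReal.ofReal_mul hM, measureReal_def, ENNReal.ofReal_toReal (measure_ne_top _ _)]
    refine (mul_le_mul_right (ENNReal.tsum_le_tsum h1) _).trans (le_of_eq ?_)
    rw [ENNReal.tsum_mul_left, ← measure_iUnion pairwise_disjoint_startCell hms, mul_left_comm,
      ENNReal.inv_mul_cancel h.measure_iUnion_ne_zero (measure_ne_top _ _), mul_one]
  have hm := h.measurable_shift hF i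
  have hi : Integrable (fun s => F (t0 s + i) s) μ[|A] := by
    refine ⟨hm.aestronglyMeasurable, ?_⟩
    rw [hasFiniteIntegral_iff_ofReal (ae_of_all _ fun s => hF0 _ s)]
    exact hl.trans_lt ENNReal.ofReal_lt_top
  refine ⟨hi, ?_⟩
  rw [integral_eq_lintegral_of_nonneg_ae (ae_of_all _ fun s => hF0 _ s) hm.aestronglyMeasurable]
  exact ENNReal.toReal_le_of_le_ofReal hM hl

lemma IsStart.integral_shift_eq_zero (h : IsStart μ ℱ τ t0 A) {F : ℕ → S → ℝ} (i : ℕ)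
    (hint : Integrable (fun s => F (t0 s + i) s) μ[|A])
    (hzero : ∀ k, ∫ s in startCell τ t0 A k, F (k + i) s ∂μ = 0) [IsProbabilityMeasure μ] :
    ∫ s, F (t0 s + i) s ∂μ[|A] = 0 := by
  have hms : ∀ k, MeasurableSet (startCell τ t0 A k) := fun k =>
    ℱ.le k _ (h.measurableSet_startCell k)
  rw [h.cond_eq] at hint ⊢
  rw [integrable_smul_measure (ENNReal.inv_ne_zero.2 (measure_ne_top _ _))
    (ENNReal.inv_ne_top.2 h.measure_iUnion_ne_zero)] at hint
  rw [integral_smul_measure, integral_iUnion hms pairwise_disjoint_startCell hint]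
  have : ∀ k, ∫ s in startCell τ t0 A k, F (t0 s + i) s ∂μ = 0 := fun k => by
    rw [← hzero k]
    exact setIntegral_congr_fun (hms k) fun s hs => by
      rw [show t0 s = k from hs.1.2]
  simp [this]

end Start

namespace IsRun

/-! ### Moments after the random starting time. -/

section Moments

variable {Ω : Type u} [Countable Ω] [MeasurableSpace Ω] [MeasurableSingletonClass Ω] {I J : ℕ}
  {P : Problem Ω I J} {V : ℝ} {W0 : Vec J} {Z0 : Vec I} {S : Type v} {mS : MeasurableSpace S}
  {μ : Measure S} {ℱ : Filtration ℕ mS} {ω : ℕ → S → Ω} {x y : ℕ → S → Vec I}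
  {W : ℕ → S → Vec J} {Z : ℕ → S → Vec I} {Mf : ℝ} {Mg : Fin J → ℝ} {lam : Mult J I} {L : ℝ}
  {t0 : S → ℕ} {A : Set S}

lemma exp_moment (h : IsRun P V W0 Z0 μ ℱ ω x y W Z) (hP : P.Standing)
    (hL : P.LipschitzConstants Mf Mg) (hI : 0 < I) (hJ : 0 < J) (hV : 0 < V)
    (hnonneg : ∀ j, 0 ≤ lam.fst j) (hlam : P.IsPolyhedral lam L)
    (hA : IsStart μ ℱ (transientTime V lam (BP P.C L) W Z) t0 A) (i : ℕ) :
    Integrable (fun s => Real.exp (rP P.C L *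
      ‖concat (W (t0 s + i) s) (Z (t0 s + i) s) - V • lam‖)) μ[|A] ∧
    ∫ s, Real.exp (rP P.C L * ‖concat (W (t0 s + i) s) (Z (t0 s + i) s) - V • lam‖) ∂μ[|A]
      ≤ momentBound P.C L := by
  have := h.prob_measure
  have hC := hP.C_pos hL hJ
  have hr := rP_pos hC hlam.1
  refine hA.integrable_shift_of_nonneg
    (F := fun n s => Real.exp (rP P.C L * ‖concat (W n s) (Z n s) - V • lam‖))
    (fun n => (((h.measurable_dist hL _ n).mono (ℱ.le n) le_rfl).const_mul _).exp)
    (fun n s => (Real.exp_pos _).le) (zero_le_one.trans (one_le_momentBound hC hlam.1)) i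
    (h.integrable_exp hP hL _ hr.le) fun k => ?_
  exact h.setIntegral_exp_add_le hP hL hI hJ hV hnonneg hlam k i (hA.measurableSet_startCell k)
    (h.setIntegral_exp_transientTime_le hP hL hI hJ hV hnonneg hlam
      (hA.event.inter (hA.time k)) k)

/-- Jensen's inequality for the logarithm. -/
lemma first_moment (h : IsRun P V W0 Z0 μ ℱ ω x y W Z) (hP : P.Standing)
    (hL : P.LipschitzConstants Mf Mg) (hI : 0 < I) (hJ : 0 < J) (hV : 0 < V)
    (hnonneg : ∀ j, 0 ≤ lam.fst j) (hlam : P.IsPolyhedral lam L)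
    (hA : IsStart μ ℱ (transientTime V lam (BP P.C L) W Z) t0 A) (i : ℕ) :
    Integrable (fun s => ‖concat (W (t0 s + i) s) (Z (t0 s + i) s) - V • lam‖) μ[|A] ∧
    ∫ s, ‖concat (W (t0 s + i) s) (Z (t0 s + i) s) - V • lam‖ ∂μ[|A] ≤ UP P.C L := by
  have := h.prob_measure
  have : IsProbabilityMeasure μ[|A] := cond_isProbabilityMeasure hA.pos
  have hC := hP.C_pos hL hJ
  have hr := rP_pos hC hlam.1
  have hM : 0 < momentBound P.C L := one_pos.trans_le (one_le_momentBound hC hlam.1)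
  obtain ⟨h1, h2⟩ := h.exp_moment hP hL hI hJ hV hnonneg hlam hA i
  have hm : Measurable fun s => ‖concat (W (t0 s + i) s) (Z (t0 s + i) s) - V • lam‖ :=
    hA.measurable_shift (F := fun n s => ‖concat (W n s) (Z n s) - V • lam‖)
      (fun n => (h.measurable_dist hL _ n).mono (ℱ.le n) le_rfl) i
  -- The tangent line of the logarithm at `momentBound`; once the exponential moment is inserted,
  -- the constants collapse to `UP`.
  have hle : ∀ a : ℝ, a ≤ (rP P.C L)⁻¹ * (Real.log (momentBound P.C L) - 1)
      + (rP P.C L)⁻¹ * (momentBound P.C L)⁻¹ * Real.exp (rP P.C L * a) := fun a => by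
    have := Real.add_one_le_exp (rP P.C L * a - Real.log (momentBound P.C L))
    rw [Real.exp_sub, Real.exp_log hM] at this
    have h3 := mul_le_mul_of_nonneg_left this (inv_pos.2 hr).le
    have h4 : (rP P.C L)⁻¹ * (rP P.C L * a) = a := inv_mul_cancel_left₀ hr.ne' a
    rw [div_eq_inv_mul] at h3
    nlinarith
  have hbound := ((integrable_const ((rP P.C L)⁻¹ * (Real.log (momentBound P.C L) - 1))).add
    (h1.const_mul ((rP P.C L)⁻¹ * (momentBound P.C L)⁻¹)))
  have hi : Integrable (fun s => ‖concat (W (t0 s + i) s) (Z (t0 s + i) s) - V • lam‖) μ[|A] :=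
    hbound.mono' hm.aestronglyMeasurable (ae_of_all _ fun s => by
      rw [norm_norm]; exact hle _)
  refine ⟨hi, (integral_mono hi hbound fun s => hle _).trans ?_⟩
  rw [integral_add' (integrable_const _) (h1.const_mul _), integral_const, probReal_univ, one_smul,
    integral_const_mul]
  have h3 := mul_le_mul_of_nonneg_left h2
    (by positivity : 0 ≤ (rP P.C L)⁻¹ * (momentBound P.C L)⁻¹)
  rw [inv_mul_cancel_right₀ hM.ne'] at h3
  have h4 : UP P.C L = (rP P.C L)⁻¹ * Real.log (momentBound P.C L) := div_eq_inv_mul _ _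
  rw [h4]
  linarith

/-- From `u ^ 2 / 2 ≤ exp u` for `u ≥ 0`. -/
lemma second_moment (h : IsRun P V W0 Z0 μ ℱ ω x y W Z) (hP : P.Standing)
    (hL : P.LipschitzConstants Mf Mg) (hI : 0 < I) (hJ : 0 < J) (hV : 0 < V)
    (hnonneg : ∀ j, 0 ≤ lam.fst j) (hlam : P.IsPolyhedral lam L)
    (hA : IsStart μ ℱ (transientTime V lam (BP P.C L) W Z) t0 A) (i : ℕ) :
    Integrable (fun s => ‖concat (W (t0 s + i) s) (Z (t0 s + i) s) - V • lam‖ ^ 2) μ[|A] ∧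
    ∫ s, ‖concat (W (t0 s + i) s) (Z (t0 s + i) s) - V • lam‖ ^ 2 ∂μ[|A] ≤ UP' P.C L := by
  have hr := rP_pos (hP.C_pos hL hJ) hlam.1
  obtain ⟨h1, h2⟩ := h.exp_moment hP hL hI hJ hV hnonneg hlam hA i
  have hm : Measurable fun s => ‖concat (W (t0 s + i) s) (Z (t0 s + i) s) - V • lam‖ :=
    hA.measurable_shift (F := fun n s => ‖concat (W n s) (Z n s) - V • lam‖)
      (fun n => (h.measurable_dist hL _ n).mono (ℱ.le n) le_rfl) i
  have hle : ∀ a : ℝ, 0 ≤ a → a ^ 2 ≤ 2 / rP P.C L ^ 2 * Real.exp (rP P.C L * a) :=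
    fun a ha => by
    have := Real.quadratic_le_exp_of_nonneg (mul_nonneg hr.le ha)
    rw [div_mul_eq_mul_div, le_div_iff₀ (by positivity)]
    nlinarith [mul_nonneg hr.le ha]
  have hbound := h1.const_mul (2 / rP P.C L ^ 2)
  have hi : Integrable (fun s => ‖concat (W (t0 s + i) s) (Z (t0 s + i) s) - V • lam‖ ^ 2)
      μ[|A] :=
    hbound.mono' (hm.pow_const 2).aestronglyMeasurable (ae_of_all _ fun s => by
      rw [norm_pow, norm_norm]; exact hle _ (norm_nonneg _))
  refine ⟨hi, (integral_mono hi hbound fun s => hle _ (norm_nonneg _)).trans ?_⟩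
  rw [integral_const_mul]
  have h3 := mul_le_mul_of_nonneg_left h2 (by positivity : 0 ≤ 2 / rP P.C L ^ 2)
  refine h3.trans (le_of_eq ?_)
  unfold UP' momentBound
  ring

/-- After a random time the queue has no deterministic bound, so integrability comes from the first
moment; the mean vanishes cell by cell. -/
lemma noise_moment (h : IsRun P V W0 Z0 μ ℱ ω x y W Z) (hP : P.Standing)
    (hL : P.LipschitzConstants Mf Mg) (hI : 0 < I) (hJ : 0 < J) (hV : 0 < V)
    (hnonneg : ∀ j, 0 ≤ lam.fst j) (hlam : P.IsPolyhedral lam L)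
    (hA : IsStart μ ℱ (transientTime V lam (BP P.C L) W Z) t0 A) (i : ℕ) :
    Integrable (fun s => P.noise (V⁻¹ • concat (W (t0 s + i) s) (Z (t0 s + i) s)).snd
      (ω (t0 s + i) s)) μ[|A] ∧
    ∫ s, P.noise (V⁻¹ • concat (W (t0 s + i) s) (Z (t0 s + i) s)).snd
      (ω (t0 s + i) s) ∂μ[|A] = 0 := by
  have := h.prob_measure
  have : IsProbabilityMeasure μ[|A] := cond_isProbabilityMeasure hA.pos
  obtain ⟨R, hR0, hR⟩ := hP.exists_bound
  obtain ⟨h1, -⟩ := h.first_moment hP hL hI hJ hV hnonneg hlam hA i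
  have hm := hA.measurable_shift
    (F := fun n s => P.noise (V⁻¹ • concat (W n s) (Z n s)).snd (ω n s))
    (fun n => h.measurable_noise hP n ((h.measurable_scaled hL n).mono (ℱ.le n) le_rfl)) i
  have hi : Integrable (fun s => P.noise (V⁻¹ • concat (W (t0 s + i) s) (Z (t0 s + i) s)).snd
      (ω (t0 s + i) s)) μ[|A] := by
    refine ((h1.add (integrable_const ‖V • lam‖)).const_mul (2 * R * V⁻¹)).mono'
      hm.aestronglyMeasurable (ae_of_all _ fun s => ?_)
    refine (hP.abs_noise_le hR _ _).trans ?_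
    rw [WithLp.smul_snd, norm_smul, Real.norm_of_nonneg (by positivity : 0 ≤ V⁻¹), ← mul_assoc]
    refine mul_le_mul_of_nonneg_left ((norm_le_norm_concat (W (t0 s + i) s) _).trans ?_) (by positivity)
    exact norm_le_norm_sub_add _ _
  refine ⟨hi, hA.integral_shift_eq_zero
    (F := fun n s => P.noise (V⁻¹ • concat (W n s) (Z n s)).snd (ω n s)) i hi fun k => ?_⟩
  have hG := ℱ.mono (Nat.le_add_right k i) _ (hA.measurableSet_startCell k)
  rw [← integral_indicator (ℱ.le _ _ hG)]
  have hψ : Measurable[ℱ (k + i)] ((startCell (transientTime V lam (BP P.C L) W Z) t0 A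
      k).indicator fun _ => (1 : ℝ)) := by
    let := ℱ (k + i)
    exact measurable_const.indicator hG
  rw [← h.integral_mul_noise hP (k + i) hψ (h.measurable_scaled hL (k + i)) (K := 1)
    (fun s => by
      refine abs_le.2 ⟨?_, Set.indicator_le_self' (fun _ _ => zero_le_one) s⟩
      exact (by norm_num : (-1 : ℝ) ≤ 0).trans (Set.indicator_nonneg (fun _ _ => zero_le_one) s))
    (h.norm_scaled_le hP hL hV (k + i))]
  refine integral_congr_ae (ae_of_all _ fun s => ?_)
  by_cases hs : s ∈ startCell (transientTime V lam (BP P.C L) W Z) t0 A k <;> simp [hs]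

end Moments

/-! ### Averages over a window -/

section Window

variable {Ω : Type u} [MeasurableSpace Ω] {I J : ℕ}
  {P : Problem Ω I J} {V : ℝ} {W0 : Vec J} {Z0 : Vec I} {S : Type v} {mS : MeasurableSpace S}
  {μ : Measure S} {ℱ : Filtration ℕ mS} {ω : ℕ → S → Ω} {x y : ℕ → S → Vec I}
  {W : ℕ → S → Vec J} {Z : ℕ → S → Vec I} {Mf : ℝ} {Mg : Fin J → ℝ} {lam : Mult J I} {L : ℝ}

lemma windowAvg_eq (x : ℕ → S → Vec I) (t0 : S → ℕ) (T : ℕ) (s : S) :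
    windowAvg x t0 T s = ∑ i ∈ Finset.range T, (T : ℝ)⁻¹ • x (t0 s + i) s := by
  unfold windowAvg
  rw [Finset.sum_Ico_eq_sum_range, Nat.add_sub_cancel_left, Finset.smul_sum]

lemma windowAvg_x_mem (h : IsRun P V W0 Z0 μ ℱ ω x y W Z) (t0 : S → ℕ) {T : ℕ} (hT : 0 < T)
    (s : S) : windowAvg x t0 T s ∈ P.evalSet := by
  rw [windowAvg_eq]
  refine Or.inr ((convex_convexHull ℝ _).sum_mem (fun _ _ => by positivity) ?_ fun i _ =>
    subset_convexHull ℝ _ (Set.mem_iUnion.2 ⟨_, h.x_mem _ s⟩))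
  have : (T : ℝ) ≠ 0 := by exact_mod_cast hT.ne'
  simp [this]

/-- The averages of `x` and `y` differ by the increment of `Z` divided by `T`; Jensen's inequality
is applied to `y` only, since `F` is convex on `Y`. -/
lemma apply_windowAvg_le (h : IsRun P V W0 Z0 μ ℱ ω x y W Z) (hP : P.Standing) (t0 : S → ℕ)
    {T : ℕ} (hT : 0 < T) (s : S) {F : Vec I → ℝ} {M : ℝ} (hF : ConvexOn ℝ P.Y F) (hM : 0 ≤ M)
    (hlip : ∀ x ∈ P.evalSet, ∀ y ∈ P.evalSet, |F x - F y| ≤ M * ‖x - y‖) (p : Mult J I) :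
    F (windowAvg x t0 T s) ≤ (T : ℝ)⁻¹ * ∑ i ∈ Finset.range T, F (y (t0 s + i) s)
      + (T : ℝ)⁻¹ * (M * (‖concat (W (t0 s) s) (Z (t0 s) s) - p‖
        + ‖concat (W (t0 s + T) s) (Z (t0 s + T) s) - p‖)) := by
  have hT' : (T : ℝ) ≠ 0 := by exact_mod_cast hT.ne'
  have hw : ∑ i ∈ Finset.range T, (T : ℝ)⁻¹ = 1 := by simp [hT']
  have hy : windowAvg y t0 T s ∈ P.Y := by
    rw [windowAvg_eq]
    exact hP.Y_convex.sum_mem (fun _ _ => by positivity) hw fun i _ => h.y_mem _ s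
  have h1 := (abs_le.1 (hlip _ (h.windowAvg_x_mem t0 hT s) _ (Or.inl hy))).2
  have h2 : F (windowAvg y t0 T s) ≤ (T : ℝ)⁻¹ * ∑ i ∈ Finset.range T, F (y (t0 s + i) s) := by
    rw [windowAvg_eq, Finset.mul_sum]
    exact hF.map_sum_le (fun _ _ => by positivity) hw fun i _ => h.y_mem _ s
  have h3 : windowAvg x t0 T s - windowAvg y t0 T s
      = (T : ℝ)⁻¹ • (Z (t0 s + T) s - Z (t0 s) s) := by
    rw [windowAvg_eq, windowAvg_eq, ← Finset.sum_sub_distrib]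
    have := Finset.sum_range_sub (fun i => Z (t0 s + i) s) T
    rw [add_zero] at this
    rw [← this, Finset.smul_sum]
    refine Finset.sum_congr rfl fun i _ => ?_
    rw [← add_assoc, h.Z_update, ← smul_sub]
    congr 1; abel
  have h4 : ‖Z (t0 s + T) s - Z (t0 s) s‖ ≤ ‖concat (W (t0 s) s) (Z (t0 s) s) - p‖
      + ‖concat (W (t0 s + T) s) (Z (t0 s + T) s) - p‖ := by
    refine (norm_le_norm_concat (W (t0 s + T) s - W (t0 s) s) _).trans ?_
    have e : concat (W (t0 s + T) s - W (t0 s) s) (Z (t0 s + T) s - Z (t0 s) s)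
        = (concat (W (t0 s + T) s) (Z (t0 s + T) s) - p)
          - (concat (W (t0 s) s) (Z (t0 s) s) - p) := by
      rw [sub_sub_sub_cancel_right]; rfl
    rw [e]
    exact (_root_.norm_sub_le _ _).trans (add_comm _ _).le
  rw [h3, norm_smul, Real.norm_of_nonneg (by positivity)] at h1
  have h5 : M * ((T : ℝ)⁻¹ * ‖Z (t0 s + T) s - Z (t0 s) s‖) ≤ M * ((T : ℝ)⁻¹ *
      (‖concat (W (t0 s) s) (Z (t0 s) s) - p‖
        + ‖concat (W (t0 s + T) s) (Z (t0 s + T) s) - p‖)) := by gcongr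
  linarith

lemma abs_apply_fst_le (q : Mult J I) (j : Fin J) : |q.fst j| ≤ ‖q‖ := by
  have h1 := PiLp.norm_apply_le q.fst j
  have h2 := WithLp.prod_norm_sq_eq_of_L2 q
  refine h1.trans (le_of_sq_le_sq (by nlinarith [sq_nonneg ‖q.snd‖]) (norm_nonneg _))

/-- The queue `W` grows at least as fast as the sum of the `g j (y t)`, and `p` cancels from the
difference of its end values. -/
lemma constraint_windowAvg_le (h : IsRun P V W0 Z0 μ ℱ ω x y W Z) (hP : P.Standing)
    (hL : P.LipschitzConstants Mf Mg) (t0 : S → ℕ) {T : ℕ} (hT : 0 < T) (s : S) (p : Mult J I)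
    (j : Fin J) :
    P.g j (windowAvg x t0 T s) ≤ (1 + Mg j) / T * (‖concat (W (t0 s) s) (Z (t0 s) s) - p‖
        + ‖concat (W (t0 s + T) s) (Z (t0 s + T) s) - p‖) := by
  have h1 := h.apply_windowAvg_le hP t0 hT s (hP.g_convex j) (hL.Mg_pos j).le (hL.g_lip j) p
  have h2 : ∑ i ∈ Finset.range T, P.g j (y (t0 s + i) s)
      ≤ ‖concat (W (t0 s) s) (Z (t0 s) s) - p‖
        + ‖concat (W (t0 s + T) s) (Z (t0 s + T) s) - p‖ := by
    have e := Finset.sum_range_sub (fun i => W (t0 s + i) s j) T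
    have e2 : ∑ i ∈ Finset.range T, P.g j (y (t0 s + i) s)
        ≤ ∑ i ∈ Finset.range T, (W (t0 s + (i + 1)) s j - W (t0 s + i) s j) :=
      Finset.sum_le_sum fun i _ => by
        rw [← add_assoc, h.W_update]
        linarith [le_max_left (W (t0 s + i) s j + P.g j (y (t0 s + i) s)) 0]
    rw [e, add_zero] at e2
    have e3 := (le_abs_self _).trans
      (abs_apply_fst_le (concat (W (t0 s + T) s) (Z (t0 s + T) s) - p) j)
    have e4 := (neg_le_abs _).trans
      (abs_apply_fst_le (concat (W (t0 s) s) (Z (t0 s) s) - p) j)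
    change W (t0 s + T) s j - p.fst j ≤ _ at e3
    change -(W (t0 s) s j - p.fst j) ≤ _ at e4
    linarith
  have h3 := mul_le_mul_of_nonneg_left h2 (by positivity : 0 ≤ (T : ℝ)⁻¹)
  rw [div_eq_mul_inv]
  linarith

/-- Drift-plus-penalty with Lyapunov function `‖Q‖² / (2V)`, centred at the origin so that the
penalty `f (y t)` remains. -/
lemma objective_windowAvg_le (h : IsRun P V W0 Z0 μ ℱ ω x y W Z) (hP : P.Standing)
    (hL : P.LipschitzConstants Mf Mg) (hV : 0 < V) (hlam : P.IsPolyhedral lam L) (t0 : S → ℕ)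
    {T : ℕ} (hT : 0 < T) (s : S) :
    P.f (windowAvg x t0 T s) ≤ P.dual lam + P.C / V
      + (T : ℝ)⁻¹ * ∑ i ∈ Finset.range T,
          P.noise (V⁻¹ • concat (W (t0 s + i) s) (Z (t0 s + i) s)).snd (ω (t0 s + i) s)
      + 1 / (2 * T * V) * ‖concat (W (t0 s) s) (Z (t0 s) s) - V • lam‖ ^ 2
      + (‖lam‖ / T + Mf / T) * (‖concat (W (t0 s) s) (Z (t0 s) s) - V • lam‖
        + ‖concat (W (t0 s + T) s) (Z (t0 s + T) s) - V • lam‖) := by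
  have hT' : (0 : ℝ) < T := by exact_mod_cast hT
  have h1 := h.apply_windowAvg_le hP t0 hT s hP.f_convex hL.Mf_pos.le hL.f_lip (V • lam)
  set Q : ℕ → Mult J I := fun i => concat (W (t0 s + i) s) (Z (t0 s + i) s) with hQ
  have hstep : ∀ i, P.f (y (t0 s + i) s) ≤ P.dual lam + P.C / V
      + P.noise (V⁻¹ • Q i).snd (ω (t0 s + i) s)
      - (1 / (2 * V) * ‖Q (i + 1)‖ ^ 2 - 1 / (2 * V) * ‖Q i‖ ^ 2) := fun i => by
    have a1 := (h.isSlot (t0 s + i) s).norm_sub_sq_le hP hL (p := 0) fun j => le_rfl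
    have a2 := (h.isSlot (t0 s + i) s).penalty_add_inner_le hP hV hlam
    -- The polyhedral gain is discarded here; it has already served for the moments.
    have a3 := mul_nonneg hlam.1.le (norm_nonneg (Q i - V • lam))
    rw [sub_zero, sub_zero] at a1
    change ‖Q (i + 1)‖ ^ 2 ≤ ‖Q i‖ ^ 2 + 2 * P.C + 2 * inner ℝ (Q i) _ at a1
    change _ ≤ _ - L * ‖Q i - V • lam‖ + V * P.noise (V⁻¹ • Q i).snd _ at a2
    refine le_of_mul_le_mul_left ?_ hV
    have e : V * (P.dual lam + P.C / V + P.noise (V⁻¹ • Q i).snd (ω (t0 s + i) s)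
        - (1 / (2 * V) * ‖Q (i + 1)‖ ^ 2 - 1 / (2 * V) * ‖Q i‖ ^ 2))
        = V * P.dual lam + P.C + V * P.noise (V⁻¹ • Q i).snd (ω (t0 s + i) s)
          - (‖Q (i + 1)‖ ^ 2 - ‖Q i‖ ^ 2) / 2 := by
      field_simp
    rw [e]
    change V * _ + inner ℝ (Q i) _ ≤ _ at a2
    linarith
  have hsum := Finset.sum_le_sum fun i (_ : i ∈ Finset.range T) => hstep i
  rw [Finset.sum_sub_distrib, Finset.sum_range_sub fun i => 1 / (2 * V) * ‖Q i‖ ^ 2,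
    Finset.sum_add_distrib, Finset.sum_const, Finset.card_range, nsmul_eq_mul] at hsum
  have hQ0 : concat (W (t0 s) s) (Z (t0 s) s) = Q 0 := rfl
  have hQT : concat (W (t0 s + T) s) (Z (t0 s + T) s) = Q T := rfl
  rw [hQ0, hQT] at h1 ⊢
  -- Both squares, of order `V ^ 2`, are expanded about `V • lam`: the main terms cancel, and the
  -- cross terms are only linear in `V`.
  have hdiff : ‖Q 0‖ ^ 2 - ‖Q T‖ ^ 2 ≤ ‖Q 0 - V • lam‖ ^ 2
      + 2 * V * ‖lam‖ * (‖Q 0 - V • lam‖ + ‖Q T - V • lam‖) := by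
    have b1 := norm_add_sq_real (Q 0 - V • lam) (V • lam)
    have b2 := norm_add_sq_real (Q T - V • lam) (V • lam)
    rw [sub_add_cancel] at b1 b2
    have b3 := real_inner_le_norm (Q 0 - V • lam) (V • lam)
    have b4 := (neg_le_abs _).trans (abs_real_inner_le_norm (Q T - V • lam) (V • lam))
    have b5 : ‖V • lam‖ = V * ‖lam‖ := by rw [norm_smul, Real.norm_of_nonneg hV.le]
    rw [b1, b2]
    rw [b5] at b3 b4 ⊢
    nlinarith [sq_nonneg ‖Q T - V • lam‖]
  have hsum' := mul_le_mul_of_nonneg_left hsum (inv_pos.2 hT').le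
  have hdiff' := mul_le_mul_of_nonneg_left hdiff (by positivity : 0 ≤ 1 / (2 * T * V))
  have e1 : (T : ℝ)⁻¹ * (T * (P.dual lam + P.C / V)
        + ∑ i ∈ Finset.range T, P.noise (V⁻¹ • Q i).snd (ω (t0 s + i) s)
        - (1 / (2 * V) * ‖Q T‖ ^ 2 - 1 / (2 * V) * ‖Q 0‖ ^ 2))
      = P.dual lam + P.C / V
        + (T : ℝ)⁻¹ * ∑ i ∈ Finset.range T, P.noise (V⁻¹ • Q i).snd (ω (t0 s + i) s)
        + 1 / (2 * T * V) * (‖Q 0‖ ^ 2 - ‖Q T‖ ^ 2) := by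
    field_simp; ring
  have e2 : 1 / (2 * T * V) * (‖Q 0 - V • lam‖ ^ 2
        + 2 * V * ‖lam‖ * (‖Q 0 - V • lam‖ + ‖Q T - V • lam‖))
      = 1 / (2 * T * V) * ‖Q 0 - V • lam‖ ^ 2
        + ‖lam‖ / T * (‖Q 0 - V • lam‖ + ‖Q T - V • lam‖) := by
    field_simp
  have e3 : (T : ℝ)⁻¹ * (Mf * (‖Q 0 - V • lam‖ + ‖Q T - V • lam‖))
      = Mf / T * (‖Q 0 - V • lam‖ + ‖Q T - V • lam‖) := by
    field_simp
  rw [e1] at hsum'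
  rw [e2] at hdiff'
  rw [e3] at h1
  linarith

end Window

end IsRun

end DriftPlusPenalty

namespace DriftPlusPenalty

namespace IsRun

/-! ### The steady state -/

variable {Ω : Type u} [MeasurableSpace Ω] {I J : ℕ}
  {P : Problem Ω I J} {V : ℝ} {W0 : Vec J} {Z0 : Vec I} {S : Type v} {mS : MeasurableSpace S}
  {μ : Measure S} {ℱ : Filtration ℕ mS} {ω : ℕ → S → Ω} {x y : ℕ → S → Vec I}
  {W : ℕ → S → Vec J} {Z : ℕ → S → Vec I} {Mf : ℝ} {Mg : Fin J → ℝ} {lam : Mult J I} {L : ℝ}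
  {τ : S → ℕ∞} {t0 : S → ℕ} {A : Set S}

lemma integrable_apply_windowAvg (h : IsRun P V W0 Z0 μ ℱ ω x y W Z) (hA : IsStart μ ℱ τ t0 A)
    {T : ℕ} (hT : 0 < T) {F G : Vec I → ℝ} (hG : Continuous G) (hFG : Set.EqOn F G P.evalSet)
    {K : ℝ} (hK : ∀ x ∈ P.evalSet, |F x| ≤ K) :
    Integrable (fun s => F (windowAvg x t0 T s)) μ[|A] := by
  have := h.prob_measure
  have hw : Measurable (windowAvg x t0 T) := by
    have e : windowAvg x t0 T = fun s => ∑ i ∈ Finset.range T, (T : ℝ)⁻¹ • x (t0 s + i) s :=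
      funext fun s => windowAvg_eq x t0 T s
    rw [e]
    have hx := fun i => hA.measurable_shift (F := x) (fun n => (h.x_meas n).mono (ℱ.le _) le_rfl) i
    exact Finset.measurable_fun_sum _ fun i _ => (measurable_const_smul (T : ℝ)⁻¹).comp (hx i)
  have e : (fun s => F (windowAvg x t0 T s)) = fun s => G (windowAvg x t0 T s) :=
    funext fun s => hFG (h.windowAvg_x_mem t0 hT s)
  refine Integrable.of_bound ?_ K (ae_of_all _ fun s => hK _ (h.windowAvg_x_mem t0 hT s))
  rw [e]
  exact (hG.measurable.comp hw).aestronglyMeasurable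

variable [Countable Ω] [MeasurableSingletonClass Ω]

lemma objective_bound (h : IsRun P V W0 Z0 μ ℱ ω x y W Z) (hP : P.Standing)
    (hL : P.LipschitzConstants Mf Mg) (hI : 0 < I) (hJ : 0 < J) (hV : 0 < V)
    (hnonneg : ∀ j, 0 ≤ lam.fst j) (hlam : P.IsPolyhedral lam L)
    (hA : IsStart μ ℱ (transientTime V lam (BP P.C L) W Z) t0 A) {T : ℕ} (hT : 0 < T) :
    Integrable (fun s => P.f (windowAvg x t0 T s)) μ[|A] ∧
    (∫ s, P.f (windowAvg x t0 T s) ∂μ[|A]) - P.fopt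
      ≤ 2 * Mf * UP P.C L / T + (UP' P.C L + 4 * V * UP P.C L * ‖lam‖) / (2 * T * V)
        + P.C / V := by
  have hT' : (0 : ℝ) < T := by exact_mod_cast hT
  have := h.prob_measure
  have : IsProbabilityMeasure μ[|A] := cond_isProbabilityMeasure hA.pos
  obtain ⟨G, hG, hfG⟩ := hL.exists_continuous_f
  obtain ⟨K, hK⟩ := hL.exists_abs_f_le hP
  have hf := h.integrable_apply_windowAvg hA hT hG hfG hK
  refine ⟨hf, ?_⟩
  obtain ⟨i0, m0⟩ := h.first_moment hP hL hI hJ hV hnonneg hlam hA 0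
  obtain ⟨iT, mT⟩ := h.first_moment hP hL hI hJ hV hnonneg hlam hA T
  obtain ⟨i2, m2⟩ := h.second_moment hP hL hI hJ hV hnonneg hlam hA 0
  simp only [add_zero] at i0 m0 i2 m2
  have iN := fun i => (h.noise_moment hP hL hI hJ hV hnonneg hlam hA i).1
  have mN := fun i => (h.noise_moment hP hL hI hJ hV hnonneg hlam hA i).2
  have iS := (integrable_finsetSum (Finset.range T) fun i _ => iN i).const_mul (T : ℝ)⁻¹
  have i1 := (integrable_const (μ := μ[|A]) (P.dual lam + P.C / V)).add iS
  have i3 := i1.add (i2.const_mul (1 / (2 * T * V)))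
  have i4 := (i0.add iT).const_mul (‖lam‖ / T + Mf / T)
  have key := integral_mono hf (i3.add i4)
    fun s => h.objective_windowAvg_le hP hL hV hlam t0 hT s
  rw [integral_add' i3 i4, integral_add' i1 (i2.const_mul _),
    integral_add' (integrable_const _) iS, integral_const_mul, integral_const_mul,
    integral_const_mul, integral_add' i0 iT, integral_finsetSum _ fun i _ => iN i,
    Finset.sum_eq_zero fun i _ => mN i, integral_const, probReal_univ, one_smul] at key
  have hfopt := hP.dual_le_fopt hL hnonneg
  have k1 := mul_le_mul_of_nonneg_left m2 (by positivity : 0 ≤ 1 / (2 * T * V))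
  have k2 := mul_le_mul_of_nonneg_left (add_le_add m0 mT)
    (by have := hL.Mf_pos; positivity : 0 ≤ ‖lam‖ / T + Mf / T)
  have e : 2 * Mf * UP P.C L / T + (UP' P.C L + 4 * V * UP P.C L * ‖lam‖) / (2 * T * V)
      = 1 / (2 * T * V) * UP' P.C L + (‖lam‖ / T + Mf / T) * (UP P.C L + UP P.C L) := by
    field_simp; ring
  rw [e]
  linarith

lemma constraint_bound (h : IsRun P V W0 Z0 μ ℱ ω x y W Z) (hP : P.Standing)
    (hL : P.LipschitzConstants Mf Mg) (hI : 0 < I) (hJ : 0 < J) (hV : 0 < V)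
    (hnonneg : ∀ j, 0 ≤ lam.fst j) (hlam : P.IsPolyhedral lam L)
    (hA : IsStart μ ℱ (transientTime V lam (BP P.C L) W Z) t0 A) {T : ℕ} (hT : 0 < T)
    (j : Fin J) :
    Integrable (fun s => P.g j (windowAvg x t0 T s)) μ[|A] ∧
    ∫ s, P.g j (windowAvg x t0 T s) ∂μ[|A]
      ≤ 2 * UP P.C L / T + 2 * Mg j * UP P.C L / T := by
  have hT' : (0 : ℝ) < T := by exact_mod_cast hT
  obtain ⟨G, hG, hgG⟩ := hL.exists_continuous_g j
  obtain ⟨K, hK⟩ := hL.exists_abs_g_le hP j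
  have hg := h.integrable_apply_windowAvg hA hT hG hgG hK
  refine ⟨hg, ?_⟩
  obtain ⟨i0, m0⟩ := h.first_moment hP hL hI hJ hV hnonneg hlam hA 0
  obtain ⟨iT, mT⟩ := h.first_moment hP hL hI hJ hV hnonneg hlam hA T
  simp only [add_zero] at i0 m0
  have key := integral_mono hg ((i0.add iT).const_mul ((1 + Mg j) / T))
    fun s => h.constraint_windowAvg_le hP hL t0 hT s (V • lam) j
  rw [integral_const_mul, integral_add' i0 iT] at key
  have k := mul_le_mul_of_nonneg_left (add_le_add m0 mT)
    (by have := hL.Mg_pos j; positivity : 0 ≤ (1 + Mg j) / T)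
  have e : 2 * UP P.C L / T + 2 * Mg j * UP P.C L / T
      = (1 + Mg j) / T * (UP P.C L + UP P.C L) := by
    field_simp; ring
  rw [e]
  linarith

end IsRun

end DriftPlusPenalty

/-! ### The theorem and the convergence time. -/

theorem mainTheorem1 {Ω : Type u} [Countable Ω] [MeasurableSpace Ω] [MeasurableSingletonClass Ω]
    {I J : ℕ} (hI : 0 < I) (hJ : 0 < J)
    (P : DriftPlusPenalty.Problem Ω I J) (hP : P.Standing)
    (Mf : ℝ) (Mg : Fin J → ℝ) (hLip : P.LipschitzConstants Mf Mg)
    (lam : DriftPlusPenalty.Mult J I) (hlam : P.IsUniqueMultiplier lam)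
    (LP : ℝ) (hLP : P.IsPolyhedral lam LP) :
    (∀ (V : ℝ) (_ : 0 < V) (W0 : DriftPlusPenalty.Vec J) (Z0 : DriftPlusPenalty.Vec I)
      (S : Type v) (mS : MeasurableSpace S) (μ : Measure S) (ℱ : Filtration ℕ mS)
      (ω : ℕ → S → Ω) (x y : ℕ → S → DriftPlusPenalty.Vec I)
      (W : ℕ → S → DriftPlusPenalty.Vec J) (Z : ℕ → S → DriftPlusPenalty.Vec I)
      (_ : DriftPlusPenalty.IsRun P V W0 Z0 μ ℱ ω x y W Z)
      (t0 : S → ℕ) (A : Set S)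
      (_ : DriftPlusPenalty.IsStart μ ℱ
        (DriftPlusPenalty.transientTime V lam (DriftPlusPenalty.BP P.C LP) W Z) t0 A)
      (T : ℕ) (_ : 0 < T),
      (Integrable (fun s => P.f (DriftPlusPenalty.windowAvg x t0 T s)) μ[|A] ∧
        (∫ s, P.f (DriftPlusPenalty.windowAvg x t0 T s) ∂μ[|A]) - P.fopt
          ≤ 2 * Mf * DriftPlusPenalty.UP P.C LP / T
            + (DriftPlusPenalty.UP' P.C LP + 4 * V * DriftPlusPenalty.UP P.C LP * ‖lam‖)
                / (2 * T * V)
            + P.C / V) ∧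
      ∀ j, Integrable (fun s => P.g j (DriftPlusPenalty.windowAvg x t0 T s)) μ[|A] ∧
        ∫ s, P.g j (DriftPlusPenalty.windowAvg x t0 T s) ∂μ[|A]
          ≤ 2 * DriftPlusPenalty.UP P.C LP / T
            + 2 * Mg j * DriftPlusPenalty.UP P.C LP / T) ∧
    (∃ κ : ℝ, 0 < κ ∧
      ∀ (ε : ℝ) (_ : 0 < ε) (W0 : DriftPlusPenalty.Vec J) (Z0 : DriftPlusPenalty.Vec I)
      (S : Type v) (mS : MeasurableSpace S) (μ : Measure S) (ℱ : Filtration ℕ mS)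
      (ω : ℕ → S → Ω) (x y : ℕ → S → DriftPlusPenalty.Vec I)
      (W : ℕ → S → DriftPlusPenalty.Vec J) (Z : ℕ → S → DriftPlusPenalty.Vec I)
      (_ : DriftPlusPenalty.IsRun P (1 / ε) W0 Z0 μ ℱ ω x y W Z)
      (t0 : S → ℕ) (A : Set S)
      (_ : DriftPlusPenalty.IsStart μ ℱ
        (DriftPlusPenalty.transientTime (1 / ε) lam (DriftPlusPenalty.BP P.C LP) W Z) t0 A)
      (T : ℕ) (_ : 1 / ε ≤ (T : ℝ)),
      (∫ s, P.f (DriftPlusPenalty.windowAvg x t0 T s) ∂μ[|A]) - P.fopt ≤ κ * ε ∧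
      ∀ j, ∫ s, P.g j (DriftPlusPenalty.windowAvg x t0 T s) ∂μ[|A] ≤ κ * ε) := by
  obtain ⟨⟨hnonneg, -⟩, -⟩ := hlam
  have hC := hP.C_pos hLip hJ
  have hU := DriftPlusPenalty.UP_nonneg hC hLP.1
  have hU' := DriftPlusPenalty.UP'_nonneg hC hLP.1
  refine ⟨fun V hV W0 Z0 S mS μ ℱ ω x y W Z h t0 A hA T hT =>
    ⟨h.objective_bound hP hLip hI hJ hV hnonneg hLP hA hT,
      h.constraint_bound hP hLip hI hJ hV hnonneg hLP hA hT⟩, ?_⟩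
  set U := DriftPlusPenalty.UP P.C LP
  set U' := DriftPlusPenalty.UP' P.C LP
  have hMf := hLip.Mf_pos
  have hMg := hLip.Mg_pos
  have hg0 : ∀ j, 0 ≤ 2 * U + 2 * Mg j * U := fun j => by
    have := hMg j
    positivity
  have hsum := Finset.sum_nonneg fun j (_ : j ∈ Finset.univ) => hg0 j
  have hκ : 0 < 2 * Mf * U + (U' / 2 + 2 * U * ‖lam‖) + P.C := by positivity
  -- The objective coefficients, plus a sum that dominates the coefficient of every single
  -- constraint.
  refine ⟨2 * Mf * U + (U' / 2 + 2 * U * ‖lam‖) + P.C + ∑ j, (2 * U + 2 * Mg j * U),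
    by linarith, ?_⟩
  intro ε hε W0 Z0 S mS μ ℱ ω x y W Z h t0 A hA T hTε
  have hV : 0 < 1 / ε := by positivity
  have hT' : (0 : ℝ) < T := hV.trans_le hTε
  have hT : 0 < T := by exact_mod_cast hT'
  -- This serves the `U'` term, which already carries a factor `ε` from `V`.
  have hT1 : (T : ℝ)⁻¹ ≤ 1 := inv_le_one_of_one_le₀ (by exact_mod_cast hT)
  have hTinv : (T : ℝ)⁻¹ ≤ ε := by
    rw [one_div] at hTε
    exact inv_le_of_inv_le₀ hε hTε
  constructor
  · refine (h.objective_bound hP hLip hI hJ hV hnonneg hLP hA hT).2.trans ?_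
    have e : 2 * Mf * U / T + (U' + 4 * (1 / ε) * U * ‖lam‖) / (2 * T * (1 / ε))
        + P.C / (1 / ε)
        = 2 * Mf * U * (T : ℝ)⁻¹ + (U' / 2 * ε) * (T : ℝ)⁻¹ + 2 * U * ‖lam‖ * (T : ℝ)⁻¹
          + P.C * ε := by
      field_simp
      ring
    have k1 : 2 * Mf * U * (T : ℝ)⁻¹ ≤ 2 * Mf * U * ε := by gcongr
    have k2 : (U' / 2 * ε) * (T : ℝ)⁻¹ ≤ U' / 2 * ε := mul_le_of_le_one_right (by positivity) hT1
    have k3 : 2 * U * ‖lam‖ * (T : ℝ)⁻¹ ≤ 2 * U * ‖lam‖ * ε := by gcongr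
    have k4 := mul_nonneg hsum hε.le
    rw [e]
    linarith
  · intro j
    refine (h.constraint_bound hP hLip hI hJ hV hnonneg hLP hA hT j).2.trans ?_
    have e : 2 * U / T + 2 * Mg j * U / T = (2 * U + 2 * Mg j * U) * (T : ℝ)⁻¹ := by
      field_simp
    rw [e]
    refine mul_le_mul ?_ hTinv (by positivity) (by linarith)
    have := Finset.single_le_sum (fun j _ => hg0 j) (Finset.mem_univ j)
    linarith
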